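/- Let $u,v\ge 1$ be coprime integers and let $X=\{a_0,\dots,a_{u-1},b_0,\dots,b_{v-1}\}$ be partially ordered by $a_i<b_j$ for all $i,j$ (and no other strict relations). Let $K$ be a field in which every nonzero element has exactly $uv$ distinct $uv$-th roots. Let $D$ be the incidence coalgebra of $X$ over $K$: it has basis $Y=\{(x,y)\in X\times X: x\le y\}$, with $\Delta(x,y)=\sum_{x\le z\le y}(x,z)\otimes(z,y)$ and $\epsilon(x,y)=\delta_{xy}$. Let $\phi_l,\phi_r$ be commuting poset automorphisms of $X$ such that $\phi_l\circ\phi_r$ acts as a $uv$-cycle on the set of pairs $(a_i,b_j)$, and let $r_0(x,y)=(\phi_l(y),\phi_r(x))$. Let $r$ be a coalgebra automorphism of $D\otimes D$ that is non-degenerate (with $\sigma=(D\otimes\epsilon)\circ r$ and $\tau=(\epsilon\otimes D)\circ r$, the maps $(D\otimes\sigma)\circ(\Delta\otimes D)$ and $(\tau\otimes D)\circ(D\otimes\Delta)$ are bijective) and that induces $r_0$, i.e. $r((x,x)\otimes(y,y))=(\phi_l(y),\phi_l(y))\otimes(\phi_r(x),\phi_r(x))$ for all $x,y\in X$. Write $r((a,b)\otimes(c,d))=\sum\lambda_{a|b|c|d}^{e|f|g|h}\,(e,f)\otimes(g,h)$.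 We say that $r$ has set-type square up to height $1$ if, with $\varphi=\phi_l\circ\phi_r$, $$r^2((a,b)\otimes(c,d))=(\varphi(a),\varphi(b))\otimes(\varphi(c),\varphi(d))$$ for all $a\le b$ and $c\le d$ in $X$ such that the heights of the intervals $[a,b]$ and $[c,d]$ add up to $1$. Then $r$ satisfies the braid equation $r_{12}r_{23}r_{12}=r_{23}r_{12}r_{23}$ and has set-type square up to height $1$ if and only if there are $\varepsilon\in\{1,-1\}$, $\alpha\in K^\times$ and $\beta_a,\beta_b,\Gamma\in K$ such that for all $i,k\in\{0,\dots,u-1\}$ and $j,l\in\{0,\dots,v-1\}$ $$\lambda_{a_i|a_i|a_k|b_l}^{\phi_l(a_k)|\phi_l(b_l)|\phi_r(a_i)|\phi_r(a_i)}=\alpha,\qquad \lambda_{b_j|b_j|a_k|b_l}^{\phi_l(a_k)|\phi_l(b_l)|\phi_r(b_j)|\phi_r(b_j)}=\varepsilon\alpha,$$ $$\lambda_{a_k|b_l|a_i|a_i}^{\phi_l(a_i)|\phi_l(a_i)|\phi_r(a_k)|\phi_r(b_l)}=\frac1\alpha,\qquad \lambda_{a_k|b_l|b_j|b_j}^{\phi_l(b_j)|\phi_l(b_j)|\phi_r(a_k)|\phi_r(b_l)}=\frac{\varepsilon}{\alpha},$$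 $$\lambda_{a_i|a_i|a_k|b_l}^{\phi_l(a_k)|\phi_l(a_k)|\phi_r(a_i)|\phi_r(a_i)}=\beta_a,\qquad \lambda_{b_j|b_j|a_k|b_l}^{\phi_l(a_k)|\phi_l(a_k)|\phi_r(b_j)|\phi_r(b_j)}=\beta_b,$$ $$\lambda_{a_k|b_l|a_i|a_i}^{\phi_l(a_i)|\phi_l(a_i)|\phi_r(a_k)|\phi_r(a_k)}=-\frac{\beta_a}{\alpha},\qquad \lambda_{a_k|b_l|b_j|b_j}^{\phi_l(b_j)|\phi_l(b_j)|\phi_r(a_k)|\phi_r(a_k)}=-\frac{\varepsilon\beta_b}{\alpha},$$ $$\lambda_{a_i|b_j|a_k|b_l}^{\phi_l(a_k)|\phi_l(a_k)|\phi_r(a_i)|\phi_r(a_i)}=\Gamma,$$ and $(\varepsilon,\alpha,\beta_a,\beta_b,\Gamma)$ belongs to one of the following eight families: 1. $\varepsilon=1$, $\alpha=1$, $\beta_b=\beta_a$ ($\beta_a,\Gamma\in K$ arbitrary); 2. $\operatorname{char}K\ne2$, $\varepsilon=1$, $\alpha=1$, $\beta_b\ne\beta_a$, $\Gamma=-\beta_a\beta_b$;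 3. $\operatorname{char}K=2$, $\varepsilon=1$, $\alpha=1$, $\beta_b\ne\beta_a$ ($\Gamma\in K$ arbitrary); 4. $\varepsilon=1$, $\alpha=-1$, $\beta_b=\beta_a$ ($\beta_a,\Gamma\in K$ arbitrary); 5. $\varepsilon=1$, $\alpha\in K^\times$ with $\alpha^2\ne1$, $\beta_b=\beta_a$, $\Gamma=-\frac{\beta_a^2}{\alpha}$ ($\beta_a\in K$ arbitrary); 6. $\varepsilon=-1$, $\alpha=1$, $\beta_a=0$ ($\beta_b,\Gamma\in K$ arbitrary); 7. $\varepsilon=-1$, $\alpha=-1$, $\beta_b=0$ ($\beta_a,\Gamma\in K$ arbitrary); 8. $\varepsilon=-1$, $\alpha\in K^\times$ with $\alpha^2\ne1$, $\beta_b=\beta_a\frac{1+\alpha}{1-\alpha}$, $\Gamma=-\frac{\beta_a^2(1+\alpha^2)}{\alpha(1-\alpha)^2}$ ($\beta_a\in K$ arbitrary). -/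

import Mathlib

open scoped TensorProduct

/-! ### The incidence coalgebra of a locally finite poset -/

/-- The underlying vector space of the incidence coalgebra of `X`: it has as basis the set `Y` of
pairs `(a, b)` with `a ≤ b`. (A type synonym, because Mathlib equips `ι →₀ K` with the coalgebra
structure in which the basis elements are group-like.) -/
def IncidenceCoalgebra (K X : Type*) [Field K] [PartialOrder X] : Type _ :=
  {p : X × X // p.1 ≤ p.2} →₀ K

namespace IncidenceCoalgebra

section Basic

variable (K : Type*) {X : Type*} [Field K] [PartialOrder X]

noncomputable instance : AddCommGroup (IncidenceCoalgebra K X) :=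
  inferInstanceAs (AddCommGroup ({p : X × X // p.1 ≤ p.2} →₀ K))

noncomputable instance : Module K (IncidenceCoalgebra K X) :=
  inferInstanceAs (Module K ({p : X × X // p.1 ≤ p.2} →₀ K))

/-- The pairs `(a, b)` with `a ≤ b`, as a basis. -/
noncomputable def basis : Module.Basis {p : X × X // p.1 ≤ p.2} K (IncidenceCoalgebra K X) :=
  Module.Basis.ofRepr (LinearEquiv.refl K ({p : X × X // p.1 ≤ p.2} →₀ K))

open Classical in
/-- The basis element `(a, b)` for `a ≤ b` (and `0` when `a ≤ b` fails, a case never used). -/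
noncomputable def pair (a b : X) : IncidenceCoalgebra K X :=
  if h : a ≤ b then basis K ⟨(a, b), h⟩ else 0

open Classical in
/-- The coordinate functional of the basis element `(a, b)` for `a ≤ b`. -/
noncomputable def coord (a b : X) : IncidenceCoalgebra K X →ₗ[K] K :=
  if h : a ≤ b then (basis K).coord ⟨(a, b), h⟩ else 0

theorem pair_of_le {a b : X} (h : a ≤ b) : pair K a b = basis K ⟨(a, b), h⟩ := by
  simp [pair, h]

end Basic

section Coalgebra

variable (K : Type*) {X : Type*} [Field K] [PartialOrder X] [LocallyFiniteOrder X]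

open Classical in
/-- `Δ(a, b) = ∑_{c ∈ [a, b]} (a, c) ⊗ (c, b)` and `ε(a, b) = δ_{ab}`. -/
noncomputable instance : CoalgebraStruct K (IncidenceCoalgebra K X) where
  comul := (basis K).constr K fun p =>
    ∑ c ∈ Finset.Icc p.1.1 p.1.2, pair K p.1.1 c ⊗ₜ[K] pair K c p.1.2
  counit := (basis K).constr K fun p => if p.1.1 = p.1.2 then 1 else 0

theorem comul_pair {a b : X} (h : a ≤ b) :
    Coalgebra.comul (R := K) (pair K a b) =
      ∑ c ∈ Finset.Icc a b, pair K a c ⊗ₜ[K] pair K c b := by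
  rw [pair_of_le K h]
  exact (basis K).constr_basis K _ _

open Classical in
theorem counit_pair {a b : X} (h : a ≤ b) :
    Coalgebra.counit (R := K) (pair K a b) = if a = b then (1 : K) else 0 := by
  rw [pair_of_le K h]
  exact (basis K).constr_basis K _ _

noncomputable instance : Coalgebra K (IncidenceCoalgebra K X) where
  coassoc := by
    refine (basis K).ext fun p => ?_
    obtain ⟨⟨a, b⟩, h⟩ := p
    rw [← pair_of_le K h]
    simp only [LinearMap.comp_apply]
    rw [comul_pair K h]
    simp only [map_sum, LinearMap.rTensor_tmul, LinearMap.lTensor_tmul]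
    have h1 : ∀ c ∈ Finset.Icc a b,
        (TensorProduct.assoc K _ _ _).toLinearMap
          (Coalgebra.comul (R := K) (pair K a c) ⊗ₜ[K] pair K c b) =
        ∑ e ∈ Finset.Icc a c, pair K a e ⊗ₜ[K] (pair K e c ⊗ₜ[K] pair K c b) := by
      intro c hc
      rw [comul_pair K (Finset.mem_Icc.1 hc).1, TensorProduct.sum_tmul, map_sum]
      rfl
    have h2 : ∀ c ∈ Finset.Icc a b,
        pair K a c ⊗ₜ[K] Coalgebra.comul (R := K) (pair K c b) =
        ∑ e ∈ Finset.Icc c b, pair K a c ⊗ₜ[K] (pair K c e ⊗ₜ[K] pair K e b) := by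
      intro c hc
      rw [comul_pair K (Finset.mem_Icc.1 hc).2, TensorProduct.tmul_sum]
    refine (Finset.sum_congr rfl h1).trans (Eq.trans ?_ (Finset.sum_congr rfl h2).symm)
    refine Finset.sum_comm' fun x y => ?_
    simp only [Finset.mem_Icc]
    constructor
    · rintro ⟨⟨h1, h2⟩, h3, h4⟩
      exact ⟨⟨h4, h2⟩, h3, h4.trans h2⟩
    · rintro ⟨⟨h1, h2⟩, h3, h4⟩
      exact ⟨⟨h3.trans h1, h2⟩, h3, h1⟩
  rTensor_counit_comp_comul := by
    classical
    refine (basis K).ext fun p => ?_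
    obtain ⟨⟨a, b⟩, h⟩ := p
    rw [← pair_of_le K h]
    simp only [LinearMap.comp_apply]
    rw [comul_pair K h]
    simp only [map_sum, LinearMap.rTensor_tmul]
    rw [Finset.sum_eq_single_of_mem a (Finset.mem_Icc.2 ⟨le_rfl, h⟩)]
    · rw [counit_pair K le_rfl]; simp
    · intro c hc hne
      rw [counit_pair K (Finset.mem_Icc.1 hc).1, if_neg hne.symm, TensorProduct.zero_tmul]
  lTensor_counit_comp_comul := by
    classical
    refine (basis K).ext fun p => ?_
    obtain ⟨⟨a, b⟩, h⟩ := p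
    rw [← pair_of_le K h]
    simp only [LinearMap.comp_apply]
    rw [comul_pair K h]
    simp only [map_sum, LinearMap.lTensor_tmul]
    rw [Finset.sum_eq_single_of_mem b (Finset.mem_Icc.2 ⟨h, le_rfl⟩)]
    · rw [counit_pair K le_rfl]; simp
    · intro c hc hne
      rw [counit_pair K (Finset.mem_Icc.1 hc).2, if_neg hne, TensorProduct.tmul_zero]

end Coalgebra

end IncidenceCoalgebra

/-! ### Non-degenerate maps, the braid equation, set-type square up to height one -/

section General

variable {K : Type*} [Field K]

/-- The braid equation `r₁₂ ∘ r₂₃ ∘ r₁₂ = r₂₃ ∘ r₁₂ ∘ r₂₃` on `(V ⊗ V) ⊗ V`. -/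
def BraidEquation {V : Type*} [AddCommGroup V] [Module K V]
    (r : V ⊗[K] V →ₗ[K] V ⊗[K] V) : Prop :=
  let r₁₂ : (V ⊗[K] V) ⊗[K] V →ₗ[K] (V ⊗[K] V) ⊗[K] V := r.rTensor V
  let r₂₃ : (V ⊗[K] V) ⊗[K] V →ₗ[K] (V ⊗[K] V) ⊗[K] V :=
    (TensorProduct.assoc K V V V).symm.toLinearMap ∘ₗ r.lTensor V ∘ₗ
      (TensorProduct.assoc K V V V).toLinearMap
  r₁₂ ∘ₗ r₂₃ ∘ₗ r₁₂ = r₂₃ ∘ₗ r₁₂ ∘ₗ r₂₃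

/-- With `σ = (D ⊗ ε) ∘ r` and `τ = (ε ⊗ D) ∘ r`, the map `r` is non-degenerate if
`(D ⊗ σ) ∘ (Δ ⊗ D)` and `(τ ⊗ D) ∘ (D ⊗ Δ)` are isomorphisms. -/
def NonDegenerate {D : Type*} [AddCommGroup D] [Module K D] [Coalgebra K D]
    (r : D ⊗[K] D →ₗ[K] D ⊗[K] D) : Prop :=
  let σ : D ⊗[K] D →ₗ[K] D :=
    (TensorProduct.rid K D).toLinearMap ∘ₗ (Coalgebra.counit (R := K) (A := D)).lTensor D ∘ₗ r
  let τ : D ⊗[K] D →ₗ[K] D :=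
    (TensorProduct.lid K D).toLinearMap ∘ₗ (Coalgebra.counit (R := K) (A := D)).rTensor D ∘ₗ r
  Function.Bijective (σ.lTensor D ∘ₗ (TensorProduct.assoc K D D D).toLinearMap ∘ₗ
      (Coalgebra.comul (R := K) (A := D)).rTensor D) ∧
    Function.Bijective (τ.rTensor D ∘ₗ (TensorProduct.assoc K D D D).symm.toLinearMap ∘ₗ
      (Coalgebra.comul (R := K) (A := D)).lTensor D)

variable {X : Type*} [PartialOrder X]

open IncidenceCoalgebra

/-- `r` restricts to `r₀` on `X × X`, where `x ∈ X` is identified with `(x, x)`. -/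
def Induces (r : IncidenceCoalgebra K X ⊗[K] IncidenceCoalgebra K X →ₗ[K]
      IncidenceCoalgebra K X ⊗[K] IncidenceCoalgebra K X)
    (r₀ : X × X → X × X) : Prop :=
  ∀ x y : X, r (pair K x x ⊗ₜ[K] pair K y y) =
    pair K (r₀ (x, y)).1 (r₀ (x, y)).1 ⊗ₜ[K] pair K (r₀ (x, y)).2 (r₀ (x, y)).2

/-- `r` has set-type square up to height one. In terms of `L x y = ˣy` and `R x y = xʸ`, where
`r₀ (x, y) = (ˣy, xʸ)`, the condition says that
`r² ((a, b) ⊗ (c, d)) = (L (L a c) (R a c), L (L a c) (R b c)) ⊗ (R (L a c) (R a c), R (L a d) (R a c))`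
whenever the heights of `[a, b]` and `[c, d]` have sum one. -/
def SetTypeSquareUpToHeightOne
    (r : IncidenceCoalgebra K X ⊗[K] IncidenceCoalgebra K X →ₗ[K]
      IncidenceCoalgebra K X ⊗[K] IncidenceCoalgebra K X)
    (r₀ : X × X → X × X) : Prop :=
  let L : X → X → X := fun x y => (r₀ (x, y)).1
  let R : X → X → X := fun x y => (r₀ (x, y)).2
  ∀ a b c d : X, a ≤ b → c ≤ d →
    Order.krullDim (Set.Icc a b) + Order.krullDim (Set.Icc c d) = 1 →
    r (r (pair K a b ⊗ₜ[K] pair K c d)) =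
      pair K (L (L a c) (R a c)) (L (L a c) (R b c)) ⊗ₜ[K]
        pair K (R (L a c) (R a c)) (R (L a d) (R a c))

/-- The coefficient `λ_{a|b|c|d}^{e|f|g|h}` of `(e, f) ⊗ (g, h)` in `r ((a, b) ⊗ (c, d))`. -/
noncomputable def coefficient
    (r : IncidenceCoalgebra K X ⊗[K] IncidenceCoalgebra K X →ₗ[K]
      IncidenceCoalgebra K X ⊗[K] IncidenceCoalgebra K X)
    (a b c d e f g h : X) : K :=
  LinearMap.mul' K K
    (TensorProduct.map (coord K e f) (coord K g h) (r (pair K a b ⊗ₜ[K] pair K c d)))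

end General

/-! ### The height one poset `{a₀, …, a_{u-1}, b₀, …, b_{v-1}}` with `aᵢ < bⱼ` -/

/-- The set `{a₀, …, a_{u-1}, b₀, …, b_{v-1}}`. -/
inductive HeightOnePoset (u v : ℕ) : Type
  | a : Fin u → HeightOnePoset u v
  | b : Fin v → HeightOnePoset u v

namespace HeightOnePoset

/-- The only strict inequalities are `aᵢ < bⱼ`. -/
inductive Le {u v : ℕ} : HeightOnePoset u v → HeightOnePoset u v → Prop
  | refl (x : HeightOnePoset u v) : Le x x
  | a_b (i : Fin u) (j : Fin v) : Le (a i) (b j)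

instance (u v : ℕ) : PartialOrder (HeightOnePoset u v) where
  le := Le
  le_refl := Le.refl
  le_trans := by
    intro x y z hxy hyz
    cases hxy with
    | refl => exact hyz
    | a_b i j => cases hyz with
      | refl => exact Le.a_b i j
  le_antisymm := by
    intro x y hxy hyx
    cases hxy with
    | refl => rfl
    | a_b i j => cases hyx

instance (u v : ℕ) : Finite (HeightOnePoset u v) :=
  Finite.of_surjective (Sum.elim a b : Fin u ⊕ Fin v → HeightOnePoset u v) (by
    rintro (i | j)
    · exact ⟨Sum.inl i, rfl⟩
    · exact ⟨Sum.inr j, rfl⟩)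

open Classical in
noncomputable instance (u v : ℕ) : LocallyFiniteOrder (HeightOnePoset u v) :=
  LocallyFiniteOrder.ofFiniteIcc fun x y => Set.toFinite (Set.Icc x y)

end HeightOnePoset

/-! ### The parameters and the families -/

open HeightOnePoset in
/-- The linear map `r` is described by the parameters `ε, α, β_a, β_b, Γ`. Here
`α_l(s)(a, b)` is the coefficient of `(φ_l a, φ_l b) ⊗ (φ_r s, φ_r s)` and `β_l(s)(a, b)` that of
`(φ_l a, φ_l a) ⊗ (φ_r s, φ_r s)` in `r ((s, s) ⊗ (a, b))`; `α_r(s)(a, b)` is the coefficient of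
`(φ_l s, φ_l s) ⊗ (φ_r a, φ_r b)` and `β_r(s)(a, b)` that of `(φ_l s, φ_l s) ⊗ (φ_r a, φ_r a)` in
`r ((a, b) ⊗ (s, s))`. -/
structure HasParameters {K : Type*} [Field K] {u v : ℕ}
    (φl φr : HeightOnePoset u v ≃o HeightOnePoset u v)
    (r : IncidenceCoalgebra K (HeightOnePoset u v) ⊗[K] IncidenceCoalgebra K (HeightOnePoset u v)
      →ₗ[K]
      IncidenceCoalgebra K (HeightOnePoset u v) ⊗[K] IncidenceCoalgebra K (HeightOnePoset u v))
    (ε α βa βb Γ : K) : Prop where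
  sign : ε = 1 ∨ ε = -1
  ne_zero : α ≠ 0
  alpha_l_a : ∀ (i k : Fin u) (l : Fin v),
    coefficient r (a i) (a i) (a k) (b l) (φl (a k)) (φl (b l)) (φr (a i)) (φr (a i)) = α
  alpha_l_b : ∀ (j : Fin v) (k : Fin u) (l : Fin v),
    coefficient r (b j) (b j) (a k) (b l) (φl (a k)) (φl (b l)) (φr (b j)) (φr (b j)) = ε * α
  alpha_r_a : ∀ (i k : Fin u) (l : Fin v),
    coefficient r (a k) (b l) (a i) (a i) (φl (a i)) (φl (a i)) (φr (a k)) (φr (b l)) = 1 / α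
  alpha_r_b : ∀ (j : Fin v) (k : Fin u) (l : Fin v),
    coefficient r (a k) (b l) (b j) (b j) (φl (b j)) (φl (b j)) (φr (a k)) (φr (b l)) = ε / α
  beta_l_a : ∀ (i k : Fin u) (l : Fin v),
    coefficient r (a i) (a i) (a k) (b l) (φl (a k)) (φl (a k)) (φr (a i)) (φr (a i)) = βa
  beta_l_b : ∀ (j : Fin v) (k : Fin u) (l : Fin v),
    coefficient r (b j) (b j) (a k) (b l) (φl (a k)) (φl (a k)) (φr (b j)) (φr (b j)) = βb
  beta_r_a : ∀ (i k : Fin u) (l : Fin v),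
    coefficient r (a k) (b l) (a i) (a i) (φl (a i)) (φl (a i)) (φr (a k)) (φr (a k)) = -(βa / α)
  beta_r_b : ∀ (j : Fin v) (k : Fin u) (l : Fin v),
    coefficient r (a k) (b l) (b j) (b j) (φl (b j)) (φl (b j)) (φr (a k)) (φr (a k)) =
      -(ε * βb / α)
  gamma : ∀ (i : Fin u) (j : Fin v) (k : Fin u) (l : Fin v),
    coefficient r (a i) (b j) (a k) (b l) (φl (a k)) (φl (a k)) (φr (a i)) (φr (a i)) = Γ

/-- The eight families of parameters, in order. -/
def InFamilies {K : Type*} [Field K] (ε α βa βb Γ : K) : Prop :=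
  (ε = 1 ∧ α = 1 ∧ βb = βa) ∨
  (ringChar K ≠ 2 ∧ ε = 1 ∧ α = 1 ∧ βb ≠ βa ∧ Γ = -(βa * βb)) ∨
  (ringChar K = 2 ∧ ε = 1 ∧ α = 1 ∧ βb ≠ βa) ∨
  (ε = 1 ∧ α = -1 ∧ βb = βa) ∨
  (ε = 1 ∧ α ≠ 0 ∧ α ^ 2 ≠ 1 ∧ βb = βa ∧ Γ = -(βa ^ 2 / α)) ∨
  (ε = -1 ∧ α = 1 ∧ βa = 0) ∨
  (ε = -1 ∧ α = -1 ∧ βb = 0) ∨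
  (ε = -1 ∧ α ≠ 0 ∧ α ^ 2 ≠ 1 ∧ βb = βa * ((1 + α) / (1 - α)) ∧
    Γ = -(βa ^ 2 * (1 + α ^ 2) / (α * (1 - α) ^ 2)))

/-!
The tensor square of an incidence coalgebra is the incidence coalgebra of `X × X`, and its
comultiplication is dual to the convolution of functions on intervals (`coord₂_comul`). A coalgebra
map which induces `r₀` therefore acts on a covering pair `z < w` of `X × X` by two scalars, because
the image is skew-primitive (`eq_edge_of_comul`), and on a square of `X × X` by the scalars of its
four edges and one further coefficient `γ` (`eq_square_of_comul`); moreover the products of the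
leading coefficients along the two sides of a square agree. Hence `r` maps the tensor product of the
blocks `⟨(s, s), (t, t), (s, t)⟩` of two arrows to such a tensor product through an explicit matrix
(`map_block`), and the braid equation becomes a family of matrix identities, one for each triple of
arrows (`braidEquation_iff`). The set-type square condition similarly expresses the scalars of the
right edges `(s, t) ⊗ (x, x)` through those of the left edges `(x, x) ⊗ (s, t)`
(`setTypeSquare_iff`).

Let `φ = φl ∘ φr`. Taking `y = φr x` in the braid equation on `(x, x) ⊗ (y, y) ⊗ (s, t)`, the scalars
of the left edges do not change when `x` is replaced by `φ x`; applying the square condition twice,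
they do not change when `φ` is applied to `x` and to `(s, t)`. As `φ` permutes the arrows
cyclically, they only depend on whether `x` is minimal or maximal. The compatibility on squares then
says that the two leading coefficients `α` and `α'` have the same square, which gives the sign `ε`
(`exists_constParams`). The braid equation on tensors with two arrows determines how `γ` changes
under `φl` and `φr`; given the relation `(α - 1) βb = (ε α - 1) βa`, which comes from tensors with one
arrow, it follows that `γ` is invariant under `φ` in each argument, hence constant (`gamma_eq`).

Once all parameters are constant, the braid equation amounts to three polynomial relations between
`ε, α, βa, βb, Γ` (`braidRelation_constParams`), whose solutions are the eight families
(`inFamilies_of_relations`, `relations_of_inFamilies`), and the square condition holds automatically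
(`setTypeSquare_of_constParams`).
-/

/-! ### Coordinates on the tensor square of an incidence coalgebra -/

namespace IncidenceCoalgebra

section Coordinates

variable {K X : Type*} [Field K] [PartialOrder X]

open Classical in
theorem coord_pair (s t : X) {a b : X} (h : a ≤ b) :
    coord K s t (pair K a b) = if s = a ∧ t = b then 1 else 0 := by
  rw [pair_of_le K h]
  unfold coord
  split_ifs with h1 h2 h2
  · obtain ⟨rfl, rfl⟩ := h2
    simp
  · rw [Module.Basis.coord_apply, Module.Basis.repr_self, Finsupp.single_apply, if_neg]
    rintro h3
    simp only [Subtype.mk.injEq, Prod.mk.injEq] at h3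
    exact h2 ⟨h3.1.symm, h3.2.symm⟩
  · obtain ⟨rfl, rfl⟩ := h2
    exact absurd h h1
  · rfl

/-- Linear maps out of an incidence coalgebra agree if they agree on all pairs. -/
theorem hom_ext {M : Type*} [AddCommMonoid M] [Module K M] {f g : IncidenceCoalgebra K X →ₗ[K] M}
    (h : ∀ a b : X, a ≤ b → f (pair K a b) = g (pair K a b)) : f = g :=
  (basis K).ext fun ⟨⟨a, b⟩, hab⟩ => by
    rw [← pair_of_le K hab]
    exact h a b hab

variable (K) in
/-- The tensor square of the incidence coalgebra of `X` is the incidence coalgebra of `X × X`; this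
is its basis element for the interval from `z` to `w`. -/
noncomputable def pair₂ (z w : X × X) : IncidenceCoalgebra K X ⊗[K] IncidenceCoalgebra K X :=
  pair K z.1 w.1 ⊗ₜ[K] pair K z.2 w.2

variable (K) in
/-- The coordinate functional of the basis element `pair₂ K z w`. -/
noncomputable def coord₂ (z w : X × X) :
    IncidenceCoalgebra K X ⊗[K] IncidenceCoalgebra K X →ₗ[K] K :=
  LinearMap.mul' K K ∘ₗ TensorProduct.map (coord K z.1 w.1) (coord K z.2 w.2)

theorem coord₂_tmul (z w : X × X) (d e : IncidenceCoalgebra K X) :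
    coord₂ K z w (d ⊗ₜ e) = coord K z.1 w.1 d * coord K z.2 w.2 e := by
  simp [coord₂]

open Classical in
theorem coord₂_pair₂ (z w : X × X) {z' w' : X × X} (h : z' ≤ w') :
    coord₂ K z w (pair₂ K z' w') = if z = z' ∧ w = w' then 1 else 0 := by
  rw [pair₂, coord₂_tmul, coord_pair _ _ h.1, coord_pair _ _ h.2]
  simp only [Prod.ext_iff]
  grind

theorem ext_coord₂ {T U : IncidenceCoalgebra K X ⊗[K] IncidenceCoalgebra K X}
    (h : ∀ z w : X × X, z ≤ w → coord₂ K z w T = coord₂ K z w U) : T = U := by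
  refine ((basis K).tensorProduct (basis K)).ext_elem fun ⟨⟨⟨a, b⟩, hab⟩, ⟨⟨c, d⟩, hcd⟩⟩ => ?_
  have key : ∀ T : IncidenceCoalgebra K X ⊗[K] IncidenceCoalgebra K X,
      ((basis K).tensorProduct (basis K)).repr T (⟨(a, b), hab⟩, ⟨(c, d), hcd⟩) =
        coord₂ K (a, c) (b, d) T := by
    intro T
    induction T using TensorProduct.induction_on with
    | zero => simp
    | tmul x y =>
      rw [coord₂_tmul]
      have h1 : a ≤ b := hab
      have h2 : c ≤ d := hcd
      simp [coord, h1, h2, mul_comm]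
    | add x y hx hy => simp [hx, hy]
  rw [key, key]
  exact h _ _ ⟨hab, hcd⟩

variable [LocallyFiniteOrder X]

open Classical in
theorem coord_comul {s m n t : X} (hsm : s ≤ m) (hnt : n ≤ t) (d : IncidenceCoalgebra K X) :
    LinearMap.mul' K K (TensorProduct.map (coord K s m) (coord K n t) (Coalgebra.comul d)) =
      if m = n then coord K s t d else 0 := by
  have h : ∀ a b : X, a ≤ b → LinearMap.mul' K K (TensorProduct.map (coord K s m) (coord K n t)
      (Coalgebra.comul (pair K a b))) = if m = n ∧ s = a ∧ t = b then 1 else 0 := by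
    intro a b hab
    have h1 : ∀ c ∈ Finset.Icc a b, LinearMap.mul' K K (TensorProduct.map (coord K s m)
        (coord K n t) (pair K a c ⊗ₜ pair K c b)) =
          if c = m then (if m = n ∧ s = a ∧ t = b then 1 else 0) else 0 := by
      intro c hc
      rw [Finset.mem_Icc] at hc
      rw [TensorProduct.map_tmul, LinearMap.mul'_apply, coord_pair _ _ hc.1, coord_pair _ _ hc.2]
      grind
    rw [comul_pair K hab, map_sum, map_sum, Finset.sum_congr rfl h1, Finset.sum_ite_eq']
    split_ifs with h2 h3 h3
    · rfl
    · rfl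
    · obtain ⟨rfl, rfl, rfl⟩ := h3
      exact absurd (Finset.mem_Icc.2 ⟨hsm, hnt⟩) h2
    · rfl
  by_cases hmn : m = n
  · rw [if_pos hmn]
    refine LinearMap.congr_fun (f := LinearMap.mul' K K ∘ₗ TensorProduct.map (coord K s m)
      (coord K n t) ∘ₗ Coalgebra.comul) (hom_ext fun a b hab => ?_) d
    simp only [LinearMap.comp_apply]
    rw [h a b hab, coord_pair _ _ hab]
    simp [hmn]
  · rw [if_neg hmn]
    refine LinearMap.congr_fun (f := LinearMap.mul' K K ∘ₗ TensorProduct.map (coord K s m)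
      (coord K n t) ∘ₗ Coalgebra.comul) (g := 0) (hom_ext fun a b hab => ?_) d
    simp only [LinearMap.comp_apply]
    rw [h a b hab, LinearMap.zero_apply]
    simp [hmn]

open Classical in
/-- The comultiplication of the tensor square is dual to the convolution of functions on the
intervals of `X × X`. -/
theorem coord₂_comul {z w z' w' : X × X} (h : z ≤ w) (h' : z' ≤ w')
    (T : IncidenceCoalgebra K X ⊗[K] IncidenceCoalgebra K X) :
    LinearMap.mul' K K (TensorProduct.map (coord₂ K z w) (coord₂ K z' w')
      (Coalgebra.comul (R := K) T)) = if w = z' then coord₂ K z w' T else 0 := by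
  induction T using TensorProduct.induction_on with
  | zero => simp
  | add x y hx hy =>
    rw [map_add, map_add, map_add, hx, hy, map_add]
    split_ifs <;> simp
  | tmul d e =>
    have h1 : ∀ p q : IncidenceCoalgebra K X ⊗[K] IncidenceCoalgebra K X,
        LinearMap.mul' K K (TensorProduct.map (coord₂ K z w) (coord₂ K z' w')
          (TensorProduct.AlgebraTensorModule.tensorTensorTensorComm K K K K _ _ _ _ (p ⊗ₜ q))) =
        LinearMap.mul' K K (TensorProduct.map (coord K z.1 w.1) (coord K z'.1 w'.1) p) *
          LinearMap.mul' K K (TensorProduct.map (coord K z.2 w.2) (coord K z'.2 w'.2) q) := by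
      intro p q
      induction p using TensorProduct.induction_on with
      | zero => simp
      | add x y hx hy => rw [TensorProduct.add_tmul]; simp only [map_add, hx, hy, add_mul]
      | tmul a b =>
        induction q using TensorProduct.induction_on with
        | zero => simp
        | add x y hx hy => rw [TensorProduct.tmul_add]; simp only [map_add, hx, hy, mul_add]
        | tmul c d =>
          simp only [TensorProduct.AlgebraTensorModule.tensorTensorTensorComm_tmul,
            TensorProduct.map_tmul, LinearMap.mul'_apply, coord₂_tmul]
          ring
    rw [TensorProduct.comul_tmul, h1, coord_comul h.1 h'.1, coord_comul h.2 h'.2, coord₂_tmul]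
    simp only [Prod.ext_iff]
    split_ifs <;> simp_all

theorem comul_pair₂ {z w : X × X} (h : z ≤ w) :
    Coalgebra.comul (R := K) (pair₂ K z w) =
      ∑ c ∈ Finset.Icc z.1 w.1, ∑ d ∈ Finset.Icc z.2 w.2,
        pair₂ K z (c, d) ⊗ₜ[K] pair₂ K (c, d) w := by
  rw [pair₂, TensorProduct.comul_tmul, comul_pair K h.1, comul_pair K h.2, TensorProduct.sum_tmul,
    map_sum]
  refine Finset.sum_congr rfl fun c _ => ?_
  rw [TensorProduct.tmul_sum, map_sum]
  rfl

end Coordinates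

end IncidenceCoalgebra

/-! ### Elements of the tensor square with prescribed comultiplication -/

namespace IncidenceCoalgebra

section SkewPrimitive

variable {K X : Type*} [Field K] [PartialOrder X]

variable (K) in
/-- The general `(z, z)`-`(w, w)`-skew-primitive element attached to a covering pair `z < w`. -/
noncomputable def edge (z w : X × X) (x y : K) :
    IncidenceCoalgebra K X ⊗[K] IncidenceCoalgebra K X :=
  x • pair₂ K z w + y • (pair₂ K z z - pair₂ K w w)

open Classical in
theorem coord₂_edge (p q : X × X) {z w : X × X} (h : z ≤ w) (x y : K) :
    coord₂ K p q (edge K z w x y) = x * (if p = z ∧ q = w then 1 else 0) +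
      y * ((if p = z ∧ q = z then 1 else 0) - (if p = w ∧ q = w then 1 else 0)) := by
  simp [edge, coord₂_pair₂, h]

variable [LocallyFiniteOrder X]

/-- Skew-primitive elements are recovered from two of their coordinates. -/
theorem eq_edge_of_comul {z₀ z₁ : X × X} (h : z₀ < z₁)
    {E : IncidenceCoalgebra K X ⊗[K] IncidenceCoalgebra K X}
    (hE : Coalgebra.comul (R := K) E = pair₂ K z₀ z₀ ⊗ₜ[K] E + E ⊗ₜ[K] pair₂ K z₁ z₁) :
    E = edge K z₀ z₁ (coord₂ K z₀ z₁ E) (coord₂ K z₀ z₀ E) := by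
  classical
  have key : ∀ z w z' w' : X × X, z ≤ w → z' ≤ w' → (if w = z' then coord₂ K z w' E else 0) =
      (if z = z₀ ∧ w = z₀ then 1 else 0) * coord₂ K z' w' E +
        coord₂ K z w E * (if z' = z₁ ∧ w' = z₁ then 1 else 0) := by
    intro z w z' w' hzw hzw'
    rw [← coord₂_comul hzw hzw', hE]
    simp [coord₂_pair₂]
  have hne := h.ne
  refine ext_coord₂ fun z w hzw => ?_
  rw [coord₂_edge _ _ h.le]
  have e1 := key z z z w le_rfl hzw
  have e2 := key z w w w hzw le_rfl
  have e3 := key z₀ z₀ z₁ z₁ le_rfl le_rfl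
  clear key hE
  grind

/-- An element whose comultiplication has the shape of that of a square `z₀ < z₁, z₂ < z₃` is
determined by the edges of that square up to the coefficient of `(z₀, z₀)`; moreover the products
of the leading coefficients along the two paths from `z₀` to `z₃` agree. -/
theorem eq_square_of_comul {z₀ z₁ z₂ z₃ : X × X} (h01 : z₀ < z₁) (h02 : z₀ < z₂) (h13 : z₁ < z₃)
    (h23 : z₂ < z₃) (h12 : z₁ ≠ z₂) {x01 y01 x02 y02 x13 y13 x23 y23 : K}
    {E : IncidenceCoalgebra K X ⊗[K] IncidenceCoalgebra K X}
    (hE : Coalgebra.comul (R := K) E = pair₂ K z₀ z₀ ⊗ₜ[K] E + E ⊗ₜ[K] pair₂ K z₃ z₃ +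
      edge K z₀ z₁ x01 y01 ⊗ₜ[K] edge K z₁ z₃ x13 y13 +
      edge K z₀ z₂ x02 y02 ⊗ₜ[K] edge K z₂ z₃ x23 y23) :
    x01 * x13 = x02 * x23 ∧
    E = (x01 * x13) • pair₂ K z₀ z₃ + (x01 * y13) • pair₂ K z₀ z₁ + (x02 * y23) • pair₂ K z₀ z₂ +
      (-(y01 * x13)) • pair₂ K z₁ z₃ + (-(y02 * x23)) • pair₂ K z₂ z₃ +
      (coord₂ K z₀ z₀ E) • pair₂ K z₀ z₀ + (-(y01 * y13)) • pair₂ K z₁ z₁ +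
      (-(y02 * y23)) • pair₂ K z₂ z₂ +
      (y01 * y13 + y02 * y23 - coord₂ K z₀ z₀ E) • pair₂ K z₃ z₃ := by
  classical
  have key : ∀ z w z' w' : X × X, z ≤ w → z' ≤ w' → (if w = z' then coord₂ K z w' E else 0) =
      (if z = z₀ ∧ w = z₀ then 1 else 0) * coord₂ K z' w' E +
        coord₂ K z w E * (if z' = z₃ ∧ w' = z₃ then 1 else 0) +
        coord₂ K z w (edge K z₀ z₁ x01 y01) * coord₂ K z' w' (edge K z₁ z₃ x13 y13) +
        coord₂ K z w (edge K z₀ z₂ x02 y02) * coord₂ K z' w' (edge K z₂ z₃ x23 y23) := by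
    intro z w z' w' hzw hzw'
    rw [← coord₂_comul hzw hzw', hE]
    simp [coord₂_pair₂]
  simp only [coord₂_edge _ _ h01.le, coord₂_edge _ _ h02.le, coord₂_edge _ _ h13.le,
    coord₂_edge _ _ h23.le] at key
  have h03 := h01.trans h13
  have hne := h01.ne
  have hne2 := h02.ne
  have hne3 := h03.ne
  have hne4 := h13.ne
  have hne5 := h23.ne
  have e3 : coord₂ K z₀ z₃ E = x01 * x13 := by
    have := key z₀ z₁ z₁ z₃ h01.le h13.le
    simpa [hne, hne.symm, hne2, hne2.symm, hne3, hne3.symm, hne4, hne4.symm, hne5, hne5.symm,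
      h12, h12.symm] using this
  have e4 : coord₂ K z₀ z₃ E = x02 * x23 := by
    have := key z₀ z₂ z₂ z₃ h02.le h23.le
    simpa [hne, hne.symm, hne2, hne2.symm, hne3, hne3.symm, hne4, hne4.symm, hne5, hne5.symm,
      h12, h12.symm] using this
  have e5 := key z₀ z₀ z₃ z₃ le_rfl le_rfl
  refine ⟨e3.symm.trans e4, ext_coord₂ fun z w hzw => ?_⟩
  simp only [map_add, map_smul, coord₂_pair₂, le_refl, h01.le, h02.le, h13.le, h23.le, h03.le,
    smul_eq_mul]
  have e1 := key z z z w le_rfl hzw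
  have e2 := key z w w w hzw le_rfl
  clear key hE h01 h02 h13 h23 h03 hzw
  by_cases hz0 : z = z₀
  · by_cases hw3 : w = z₃
    · grind
    · grind
  · by_cases hw3 : w = z₃
    · grind
    · grind

end SkewPrimitive

end IncidenceCoalgebra

/-! ### The action of a coalgebra map on the blocks spanned by two covering pairs -/

namespace HeightOnePoset

open IncidenceCoalgebra

variable {K : Type*} [Field K] {u v : ℕ}

theorem lt_iff_exists {s t : HeightOnePoset u v} : s < t ↔ ∃ i j, s = a i ∧ t = b j := by
  constructor
  · intro h
    obtain ⟨h1, h2⟩ := lt_iff_le_and_ne.1 h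
    cases h1 with
    | refl => exact absurd rfl h2
    | a_b i j => exact ⟨i, j, rfl, rfl⟩
  · rintro ⟨i, j, rfl, rfl⟩
    exact lt_of_le_of_ne (Le.a_b i j) (by rintro ⟨⟩)

theorem a_lt_b (i : Fin u) (j : Fin v) : (a i : HeightOnePoset u v) < b j :=
  lt_iff_exists.2 ⟨i, j, rfl, rfl⟩

theorem Icc_of_lt [DecidableEq (HeightOnePoset u v)] {s t : HeightOnePoset u v} (h : s < t) :
    Finset.Icc s t = {s, t} := by
  ext x
  simp only [Finset.mem_Icc, Finset.mem_insert, Finset.mem_singleton]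
  constructor
  · rintro ⟨h1, h2⟩
    rcases h1.eq_or_lt with rfl | h1
    · exact Or.inl rfl
    rcases h2.eq_or_lt with rfl | h2
    · exact Or.inr rfl
    obtain ⟨i, j, -, rfl⟩ := lt_iff_exists.1 h1
    obtain ⟨i', j', h3, -⟩ := lt_iff_exists.1 h2
    cases h3
  · rintro (rfl | rfl)
    · exact ⟨le_rfl, h.le⟩
    · exact ⟨h.le, le_rfl⟩

/-- Every element is the smaller or the larger element of a pair `s < t`. -/
theorem exists_lt (hu : 0 < u) (hv : 0 < v) (x : HeightOnePoset u v) :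
    ∃ s t, s < t ∧ (x = s ∨ x = t) := by
  rcases x with i | j
  · exact ⟨a i, b ⟨0, hv⟩, a_lt_b _ _, Or.inl rfl⟩
  · exact ⟨a ⟨0, hu⟩, b j, a_lt_b _ _, Or.inr rfl⟩

/-- The positions in the basis `(s, s), (t, t), (s, t)` of the subcoalgebra spanned by a covering
pair `s < t`. -/
inductive Slot : Type
  | lo | hi | arr
  deriving DecidableEq

open Slot

instance : Fintype Slot := ⟨{lo, hi, arr}, fun i => by cases i <;> decide⟩

theorem Slot.sum_eq {M : Type*} [AddCommMonoid M] (f : Slot → M) :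
    ∑ i, f i = f lo + f hi + f arr := by
  have : (Finset.univ : Finset Slot) = {lo, hi, arr} := rfl
  rw [this, Finset.sum_insert (by decide), Finset.sum_insert (by decide), Finset.sum_singleton,
    add_assoc]

variable (K) in
/-- The basis `(s, s), (t, t), (s, t)` of the subcoalgebra spanned by a pair `p = (s, t)` with
`s < t`. -/
noncomputable def block (p : HeightOnePoset u v × HeightOnePoset u v) :
    Slot → IncidenceCoalgebra K (HeightOnePoset u v)
  | lo => pair K p.1 p.1
  | hi => pair K p.2 p.2
  | arr => pair K p.1 p.2

variable (K) in
/-- The coordinate functionals of `block K p`. -/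
noncomputable def blockCoord (p : HeightOnePoset u v × HeightOnePoset u v) :
    Slot → IncidenceCoalgebra K (HeightOnePoset u v) →ₗ[K] K
  | lo => coord K p.1 p.1
  | hi => coord K p.2 p.2
  | arr => coord K p.1 p.2

theorem blockCoord_block {p : HeightOnePoset u v × HeightOnePoset u v} (h : p.1 < p.2)
    (i j : Slot) : blockCoord K p i (block K p j) = if i = j then 1 else 0 := by
  have := h.ne
  cases i <;> cases j <;> simp [blockCoord, block, coord_pair, h.le, this, this.symm]

/-- The scalars describing a coalgebra map on the tensor product of two blocks: `α` stands for the
coefficient of an edge and `β` for that of its smaller vertex, `l` refers to the edges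
`(x, x) ⊗ (s, t)` and `r` to the edges `(s, t) ⊗ (x, x)`, and `Lo`, `Hi` tell whether the group-like
factor `(x, x)` is the smaller or the larger vertex of its block. Finally `γ` is the coefficient of
the smallest vertex in the image of the product of the two arrows. -/
structure BlockParams (K : Type*) where
  (αlLo αlHi αrLo αrHi βlLo βlHi βrLo βrHi γ : K)

/-- The matrix of a coalgebra map on the tensor product of two blocks: `P.mat i j k l` is the
coefficient of the `k`-th tensor the `l`-th basis element in the image of the `i`-th tensor the
`j`-th basis element. -/
def BlockParams.mat (P : BlockParams K) : Slot → Slot → Slot → Slot → K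
  | lo, lo, lo, lo => 1
  | lo, hi, hi, lo => 1
  | hi, lo, lo, hi => 1
  | hi, hi, hi, hi => 1
  | lo, arr, arr, lo => P.αlLo
  | lo, arr, lo, lo => P.βlLo
  | lo, arr, hi, lo => -P.βlLo
  | hi, arr, arr, hi => P.αlHi
  | hi, arr, lo, hi => P.βlHi
  | hi, arr, hi, hi => -P.βlHi
  | arr, lo, lo, arr => P.αrLo
  | arr, lo, lo, lo => P.βrLo
  | arr, lo, lo, hi => -P.βrLo
  | arr, hi, hi, arr => P.αrHi
  | arr, hi, hi, lo => P.βrHi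
  | arr, hi, hi, hi => -P.βrHi
  | arr, arr, arr, arr => P.αlLo * P.αrHi
  | arr, arr, arr, lo => P.αlLo * P.βrHi
  | arr, arr, lo, arr => P.αrLo * P.βlHi
  | arr, arr, hi, arr => -(P.βlLo * P.αrHi)
  | arr, arr, arr, hi => -(P.βrLo * P.αlHi)
  | arr, arr, lo, lo => P.γ
  | arr, arr, hi, lo => -(P.βlLo * P.βrHi)
  | arr, arr, lo, hi => -(P.βrLo * P.βlHi)
  | arr, arr, hi, hi => P.βlLo * P.βrHi + P.βrLo * P.βlHi - P.γ
  | _, _, _, _ => 0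

section Structure

variable (r : IncidenceCoalgebra K (HeightOnePoset u v) ⊗[K] IncidenceCoalgebra K (HeightOnePoset u v)
    →ₗ[K] IncidenceCoalgebra K (HeightOnePoset u v) ⊗[K] IncidenceCoalgebra K (HeightOnePoset u v))
  (φl φr : HeightOnePoset u v ≃o HeightOnePoset u v)

/-- The coefficient of the edge in `r ((x, x) ⊗ (p.1, p.2))`. -/
noncomputable def αl (x : HeightOnePoset u v) (p : HeightOnePoset u v × HeightOnePoset u v) : K :=
  coefficient r x x p.1 p.2 (φl p.1) (φl p.2) (φr x) (φr x)

/-- The coefficient of the smaller vertex in `r ((x, x) ⊗ (p.1, p.2))`. -/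
noncomputable def βl (x : HeightOnePoset u v) (p : HeightOnePoset u v × HeightOnePoset u v) : K :=
  coefficient r x x p.1 p.2 (φl p.1) (φl p.1) (φr x) (φr x)

/-- The coefficient of the edge in `r ((p.1, p.2) ⊗ (x, x))`. -/
noncomputable def αr (x : HeightOnePoset u v) (p : HeightOnePoset u v × HeightOnePoset u v) : K :=
  coefficient r p.1 p.2 x x (φl x) (φl x) (φr p.1) (φr p.2)

/-- The coefficient of the smaller vertex in `r ((p.1, p.2) ⊗ (x, x))`. -/
noncomputable def βr (x : HeightOnePoset u v) (p : HeightOnePoset u v × HeightOnePoset u v) : K :=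
  coefficient r p.1 p.2 x x (φl x) (φl x) (φr p.1) (φr p.1)

/-- The coefficient of the smallest vertex in `r ((p.1, p.2) ⊗ (q.1, q.2))`. -/
noncomputable def γ (p q : HeightOnePoset u v × HeightOnePoset u v) : K :=
  coefficient r p.1 p.2 q.1 q.2 (φl q.1) (φl q.1) (φr p.1) (φr p.1)

/-- The scalars describing `r` on the blocks of `p` and `q`. -/
noncomputable def blockParams (p q : HeightOnePoset u v × HeightOnePoset u v) : BlockParams K where
  αlLo := αl r φl φr p.1 q
  αlHi := αl r φl φr p.2 q
  αrLo := αr r φl φr q.1 p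
  αrHi := αr r φl φr q.2 p
  βlLo := βl r φl φr p.1 q
  βlHi := βl r φl φr p.2 q
  βrLo := βr r φl φr q.1 p
  βrHi := βr r φl φr q.2 p
  γ := γ r φl φr p q

variable {r φl φr}
  (hr : ∀ T, Coalgebra.comul (R := K) (r T) = TensorProduct.map r r (Coalgebra.comul (R := K) T))
  (hind : Induces r (fun p => (φl p.2, φr p.1)))

include hind in
theorem map_vertex (x y : HeightOnePoset u v) :
    r (pair₂ K (x, y) (x, y)) = pair₂ K (φl y, φr x) (φl y, φr x) :=
  hind x y

include hr hind

theorem map_left_edge (x : HeightOnePoset u v) {p : HeightOnePoset u v × HeightOnePoset u v}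
    (hp : p.1 < p.2) :
    r (pair₂ K (x, p.1) (x, p.2)) =
      edge K (φl p.1, φr x) (φl p.2, φr x) (αl r φl φr x p) (βl r φl φr x p) := by
  classical
  refine eq_edge_of_comul (Prod.mk_lt_mk_iff_left.2 (φl.lt_iff_lt.2 hp)) ?_
  rw [hr, comul_pair₂ (Prod.mk_le_mk.2 ⟨le_rfl, hp.le⟩)]
  simp only [Finset.Icc_self, Finset.sum_singleton, Icc_of_lt hp, Finset.sum_pair hp.ne, map_add,
    TensorProduct.map_tmul, map_vertex hind]

theorem map_right_edge (x : HeightOnePoset u v) {p : HeightOnePoset u v × HeightOnePoset u v}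
    (hp : p.1 < p.2) :
    r (pair₂ K (p.1, x) (p.2, x)) =
      edge K (φl x, φr p.1) (φl x, φr p.2) (αr r φl φr x p) (βr r φl φr x p) := by
  classical
  refine eq_edge_of_comul (Prod.mk_lt_mk_iff_right.2 (φr.lt_iff_lt.2 hp)) ?_
  rw [hr, comul_pair₂ (Prod.mk_le_mk.2 ⟨hp.le, le_rfl⟩)]
  simp only [Finset.Icc_self, Finset.sum_singleton, Icc_of_lt hp, Finset.sum_pair hp.ne, map_add,
    TensorProduct.map_tmul, map_vertex hind]

theorem map_square {p q : HeightOnePoset u v × HeightOnePoset u v} (hp : p.1 < p.2)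
    (hq : q.1 < q.2) :
    αl r φl φr p.1 q * αr r φl φr q.2 p = αr r φl φr q.1 p * αl r φl φr p.2 q ∧
    r (block K p arr ⊗ₜ block K q arr) = ∑ k, ∑ l, (blockParams r φl φr p q).mat arr arr k l •
      (block K (Prod.map φl φl q) k ⊗ₜ[K] block K (Prod.map φr φr p) l) := by
  classical
  have hp' := φr.lt_iff_lt.2 hp
  have hq' := φl.lt_iff_lt.2 hq
  have := eq_square_of_comul (K := K) (E := r (pair₂ K (p.1, q.1) (p.2, q.2)))
    (z₀ := (φl q.1, φr p.1)) (z₁ := (φl q.2, φr p.1)) (z₂ := (φl q.1, φr p.2))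
    (z₃ := (φl q.2, φr p.2)) (Prod.mk_lt_mk_iff_left.2 hq') (Prod.mk_lt_mk_iff_right.2 hp')
    (Prod.mk_lt_mk_iff_right.2 hp') (Prod.mk_lt_mk_iff_left.2 hq')
    (fun h => hq'.ne (Prod.ext_iff.1 h).1.symm)
    (x01 := αl r φl φr p.1 q) (y01 := βl r φl φr p.1 q)
    (x02 := αr r φl φr q.1 p) (y02 := βr r φl φr q.1 p)
    (x13 := αr r φl φr q.2 p) (y13 := βr r φl φr q.2 p)
    (x23 := αl r φl φr p.2 q) (y23 := βl r φl φr p.2 q) (by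
      rw [hr, comul_pair₂ (Prod.mk_le_mk.2 ⟨hp.le, hq.le⟩)]
      simp only [Icc_of_lt hp, Icc_of_lt hq, Finset.sum_pair hp.ne, Finset.sum_pair hq.ne, map_add,
        TensorProduct.map_tmul, map_vertex hind, map_left_edge hr hind _ hq,
        map_right_edge hr hind _ hp]
      abel)
  refine ⟨this.1, ?_⟩
  simp only [Slot.sum_eq]
  refine this.2.trans ?_
  have hγ : coord₂ K (φl q.1, φr p.1) (φl q.1, φr p.1) (r (pair₂ K (p.1, q.1) (p.2, q.2))) =
    γ r φl φr p q := rfl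
  rw [hγ]
  simp only [pair₂, block, BlockParams.mat, blockParams, Prod.map_fst, Prod.map_snd]
  module

/-- On the tensor product of the blocks of `p` and `q`, the map `r` is given by the matrix of
`blockParams r φl φr p q`, with values in the tensor product of the blocks of `φl q` and `φr p`. -/
theorem map_block {p q : HeightOnePoset u v × HeightOnePoset u v} (hp : p.1 < p.2)
    (hq : q.1 < q.2) (i j : Slot) :
    r (block K p i ⊗ₜ block K q j) = ∑ k, ∑ l, (blockParams r φl φr p q).mat i j k l •
      (block K (Prod.map φl φl q) k ⊗ₜ[K] block K (Prod.map φr φr p) l) := by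
  cases i <;> cases j
  case arr.arr => exact (map_square hr hind hp hq).2
  all_goals simp only [Slot.sum_eq]
  case lo.lo => refine (map_vertex hind p.1 q.1).trans ?_; simp [pair₂, block, BlockParams.mat]
  case lo.hi => refine (map_vertex hind p.1 q.2).trans ?_; simp [pair₂, block, BlockParams.mat]
  case hi.lo => refine (map_vertex hind p.2 q.1).trans ?_; simp [pair₂, block, BlockParams.mat]
  case hi.hi => refine (map_vertex hind p.2 q.2).trans ?_; simp [pair₂, block, BlockParams.mat]
  case lo.arr =>
    refine (map_left_edge hr hind p.1 hq).trans ?_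
    simp only [edge, pair₂, block, BlockParams.mat, blockParams, Prod.map_fst, Prod.map_snd]
    module
  case hi.arr =>
    refine (map_left_edge hr hind p.2 hq).trans ?_
    simp only [edge, pair₂, block, BlockParams.mat, blockParams, Prod.map_fst, Prod.map_snd]
    module
  case arr.lo =>
    refine (map_right_edge hr hind q.1 hp).trans ?_
    simp only [edge, pair₂, block, BlockParams.mat, blockParams, Prod.map_fst, Prod.map_snd]
    module
  case arr.hi =>
    refine (map_right_edge hr hind q.2 hp).trans ?_
    simp only [edge, pair₂, block, BlockParams.mat, blockParams, Prod.map_fst, Prod.map_snd]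
    module

end Structure

end HeightOnePoset

/-! ### The braid equation on blocks -/

namespace HeightOnePoset

open IncidenceCoalgebra Slot

section BraidRelation

variable {K : Type*} [Field K]

/-- Equality of the matrices of `r₁₂ ∘ r₂₃ ∘ r₁₂` and `r₂₃ ∘ r₁₂ ∘ r₂₃` on the tensor product of
three blocks, when the successive factors act through the matrices of `P₁, P₂, P₃` and of
`P₄, P₅, P₆` respectively. -/
def BraidRelation (P₁ P₂ P₃ P₄ P₅ P₆ : BlockParams K) : Prop :=
  ∀ x y z x' y' z' : Slot,
    ∑ k, ∑ l, ∑ m, P₁.mat x y k l * P₂.mat l z m z' * P₃.mat k m x' y' =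
      ∑ k, ∑ l, ∑ m, P₄.mat y z k l * P₅.mat x k x' m * P₆.mat m l y' z'

theorem sum_reorder_left {V : Type*} [AddCommGroup V] [Module K V] (A : Slot → Slot → K)
    (B : Slot → Slot → Slot → K) (C : Slot → Slot → Slot → Slot → K)
    (T : Slot → Slot → Slot → V) :
    ∑ k, ∑ l, A k l • ∑ m, ∑ n, B l m n • ∑ a, ∑ b, C k m a b • T a b n =
      ∑ a, ∑ b, ∑ n, (∑ k, ∑ l, ∑ m, A k l * B l m n * C k m a b) • T a b n := by
  simp only [Finset.smul_sum, Finset.sum_smul, smul_smul]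
  have h1 : ∀ f : Slot → Slot → Slot → Slot → Slot → Slot → V,
      ∑ k, ∑ l, ∑ m, ∑ n, ∑ a, ∑ b, f k l m n a b =
      ∑ a, ∑ b, ∑ n, ∑ k, ∑ l, ∑ m, f k l m n a b := by
    intro f
    have := Fintype.sum_equiv (⟨fun t => (t.2.2.2.2.1, t.2.2.2.2.2, t.2.2.2.1, t.1, t.2.1, t.2.2.1),
      fun t => (t.2.2.2.1, t.2.2.2.2.1, t.2.2.2.2.2, t.2.2.1, t.1, t.2.1), fun _ => rfl,
      fun _ => rfl⟩ : Slot × Slot × Slot × Slot × Slot × Slot ≃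
        Slot × Slot × Slot × Slot × Slot × Slot)
      (fun t => f t.1 t.2.1 t.2.2.1 t.2.2.2.1 t.2.2.2.2.1 t.2.2.2.2.2)
      (fun t => f t.2.2.2.1 t.2.2.2.2.1 t.2.2.2.2.2 t.2.2.1 t.1 t.2.1) (fun _ => rfl)
    simpa only [Fintype.sum_prod_type] using this
  rw [h1]
  simp only [mul_assoc]

theorem sum_reorder_right {V : Type*} [AddCommGroup V] [Module K V] (A : Slot → Slot → K)
    (B : Slot → Slot → Slot → K) (C : Slot → Slot → Slot → Slot → K)
    (T : Slot → Slot → Slot → V) :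
    ∑ k, ∑ l, A k l • ∑ n, ∑ m, B k n m • ∑ a, ∑ b, C m l a b • T n a b =
      ∑ n, ∑ a, ∑ b, (∑ k, ∑ l, ∑ m, A k l * B k n m * C m l a b) • T n a b := by
  simp only [Finset.smul_sum, Finset.sum_smul, smul_smul]
  have h1 : ∀ f : Slot → Slot → Slot → Slot → Slot → Slot → V,
      ∑ k, ∑ l, ∑ n, ∑ m, ∑ a, ∑ b, f k l m n a b =
      ∑ n, ∑ a, ∑ b, ∑ k, ∑ l, ∑ m, f k l m n a b := by
    intro f
    have := Fintype.sum_equiv (⟨fun t => (t.2.2.1, t.2.2.2.2.1, t.2.2.2.2.2, t.1, t.2.1, t.2.2.2.1),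
      fun t => (t.2.2.2.1, t.2.2.2.2.1, t.1, t.2.2.2.2.2, t.2.1, t.2.2.1), fun _ => rfl,
      fun _ => rfl⟩ : Slot × Slot × Slot × Slot × Slot × Slot ≃
        Slot × Slot × Slot × Slot × Slot × Slot)
      (fun t => f t.1 t.2.1 t.2.2.2.1 t.2.2.1 t.2.2.2.2.1 t.2.2.2.2.2)
      (fun t => f t.2.2.2.1 t.2.2.2.2.1 t.2.2.2.2.2 t.1 t.2.1 t.2.2.1) (fun _ => rfl)
    simpa only [Fintype.sum_prod_type] using this
  rw [h1]
  simp only [mul_assoc]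

end BraidRelation

section Braid

variable {K : Type*} [Field K] {u v : ℕ}
  {r : IncidenceCoalgebra K (HeightOnePoset u v) ⊗[K] IncidenceCoalgebra K (HeightOnePoset u v)
    →ₗ[K] IncidenceCoalgebra K (HeightOnePoset u v) ⊗[K] IncidenceCoalgebra K (HeightOnePoset u v)}
  {φl φr : HeightOnePoset u v ≃o HeightOnePoset u v}

variable (K) in
/-- The basis of the tensor product of three blocks. -/
noncomputable def block₃ (p q w : HeightOnePoset u v × HeightOnePoset u v) (x y z : Slot) :
    (IncidenceCoalgebra K (HeightOnePoset u v) ⊗[K] IncidenceCoalgebra K (HeightOnePoset u v)) ⊗[K]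
      IncidenceCoalgebra K (HeightOnePoset u v) :=
  (block K p x ⊗ₜ block K q y) ⊗ₜ block K w z

theorem block₃_coeff_injective {p q w : HeightOnePoset u v × HeightOnePoset u v} (hp : p.1 < p.2)
    (hq : q.1 < q.2) (hw : w.1 < w.2) {c d : Slot → Slot → Slot → K}
    (h : ∑ x, ∑ y, ∑ z, c x y z • block₃ K p q w x y z =
      ∑ x, ∑ y, ∑ z, d x y z • block₃ K p q w x y z) (x y z : Slot) : c x y z = d x y z := by
  have key : ∀ c : Slot → Slot → Slot → K, (LinearMap.mul' K K ∘ₗ TensorProduct.map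
      (LinearMap.mul' K K ∘ₗ TensorProduct.map (blockCoord K p x) (blockCoord K q y))
      (blockCoord K w z)) (∑ x, ∑ y, ∑ z, c x y z • block₃ K p q w x y z) = c x y z := by
    intro c
    simp only [map_sum, map_smul, block₃, LinearMap.comp_apply, TensorProduct.map_tmul,
      LinearMap.mul'_apply, blockCoord_block hp, blockCoord_block hq, blockCoord_block hw,
      smul_eq_mul]
    simp
  rw [← key c, h, key d]

/-- Every basis element of the incidence coalgebra belongs to some block. -/
theorem exists_block (hu : 0 < u) (hv : 0 < v) {x y : HeightOnePoset u v} (h : x ≤ y) :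
    ∃ p : HeightOnePoset u v × HeightOnePoset u v, p.1 < p.2 ∧ ∃ i, pair K x y = block K p i := by
  rcases h.eq_or_lt with rfl | h
  · obtain ⟨s, t, hst, rfl | rfl⟩ := exists_lt hu hv x
    · exact ⟨(x, t), hst, lo, rfl⟩
    · exact ⟨(s, x), hst, hi, rfl⟩
  · exact ⟨(x, y), h, arr, rfl⟩

/-- The map `r` acting on the first two tensor factors. -/
noncomputable def leg₁₂ {V : Type*} [AddCommGroup V] [Module K V]
    (r : V ⊗[K] V →ₗ[K] V ⊗[K] V) : (V ⊗[K] V) ⊗[K] V →ₗ[K] (V ⊗[K] V) ⊗[K] V :=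
  r.rTensor V

/-- The map `r` acting on the last two tensor factors. -/
noncomputable def leg₂₃ {V : Type*} [AddCommGroup V] [Module K V]
    (r : V ⊗[K] V →ₗ[K] V ⊗[K] V) : (V ⊗[K] V) ⊗[K] V →ₗ[K] (V ⊗[K] V) ⊗[K] V :=
  (TensorProduct.assoc K V V V).symm.toLinearMap ∘ₗ r.lTensor V ∘ₗ
    (TensorProduct.assoc K V V V).toLinearMap

theorem leg₁₂_block₃
    (hr : ∀ T, Coalgebra.comul (R := K) (r T) = TensorProduct.map r r (Coalgebra.comul (R := K) T))
    (hind : Induces r (fun p => (φl p.2, φr p.1)))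
    {p q : HeightOnePoset u v × HeightOnePoset u v} (hp : p.1 < p.2)
    (hq : q.1 < q.2) (w : HeightOnePoset u v × HeightOnePoset u v) (x y z : Slot) :
    leg₁₂ r (block₃ K p q w x y z) = ∑ k, ∑ l, (blockParams r φl φr p q).mat x y k l •
      block₃ K (Prod.map φl φl q) (Prod.map φr φr p) w k l z := by
  simp only [leg₁₂, block₃, LinearMap.rTensor_tmul, map_block hr hind hp hq, TensorProduct.sum_tmul,
    TensorProduct.smul_tmul']

theorem leg₂₃_block₃
    (hr : ∀ T, Coalgebra.comul (R := K) (r T) = TensorProduct.map r r (Coalgebra.comul (R := K) T))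
    (hind : Induces r (fun p => (φl p.2, φr p.1)))
    (p : HeightOnePoset u v × HeightOnePoset u v) {q w : HeightOnePoset u v × HeightOnePoset u v}
    (hq : q.1 < q.2) (hw : w.1 < w.2) (x y z : Slot) :
    leg₂₃ r (block₃ K p q w x y z) = ∑ k, ∑ l, (blockParams r φl φr q w).mat y z k l •
      block₃ K p (Prod.map φl φl w) (Prod.map φr φr q) x k l := by
  simp only [leg₂₃, block₃, LinearMap.comp_apply, LinearEquiv.coe_coe, TensorProduct.assoc_tmul,
    LinearMap.lTensor_tmul, map_block hr hind hq hw, TensorProduct.tmul_sum, map_sum,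
    TensorProduct.tmul_smul, map_smul, TensorProduct.assoc_symm_tmul]

theorem map_lt_map (φ : HeightOnePoset u v ≃o HeightOnePoset u v)
    {p : HeightOnePoset u v × HeightOnePoset u v} (hp : p.1 < p.2) :
    (Prod.map φ φ p).1 < (Prod.map φ φ p).2 :=
  φ.lt_iff_lt.2 hp

theorem map_comm (hcomm : ∀ x, φl (φr x) = φr (φl x))
    (p : HeightOnePoset u v × HeightOnePoset u v) :
    Prod.map φl φl (Prod.map φr φr p) = Prod.map φr φr (Prod.map φl φl p) :=
  Prod.ext (hcomm _) (hcomm _)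

section

variable
  (hr : ∀ T, Coalgebra.comul (R := K) (r T) = TensorProduct.map r r (Coalgebra.comul (R := K) T))
  (hind : Induces r (fun p => (φl p.2, φr p.1)))

include hr hind

theorem leg₁₂_leg₂₃_leg₁₂_block₃ {p q w : HeightOnePoset u v × HeightOnePoset u v} (hp : p.1 < p.2)
    (hq : q.1 < q.2) (hw : w.1 < w.2) (x y z : Slot) :
    leg₁₂ r (leg₂₃ r (leg₁₂ r (block₃ K p q w x y z))) = ∑ x', ∑ y', ∑ z',
      (∑ k, ∑ l, ∑ m, (blockParams r φl φr p q).mat x y k l *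
        (blockParams r φl φr (Prod.map φr φr p) w).mat l z m z' *
        (blockParams r φl φr (Prod.map φl φl q) (Prod.map φl φl w)).mat k m x' y') •
      block₃ K (Prod.map φl φl (Prod.map φl φl w)) (Prod.map φr φr (Prod.map φl φl q))
        (Prod.map φr φr (Prod.map φr φr p)) x' y' z' := by
  simp only [leg₁₂_block₃ hr hind hp hq, map_sum, map_smul,
    leg₂₃_block₃ hr hind _ (map_lt_map φr hp) hw,
    leg₁₂_block₃ hr hind (map_lt_map φl hq) (map_lt_map φl hw)]
  exact sum_reorder_left ((blockParams r φl φr p q).mat x y)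
    (fun l => (blockParams r φl φr (Prod.map φr φr p) w).mat l z) _ _

theorem leg₂₃_leg₁₂_leg₂₃_block₃ (hcomm : ∀ x, φl (φr x) = φr (φl x))
    {p q w : HeightOnePoset u v × HeightOnePoset u v} (hp : p.1 < p.2)
    (hq : q.1 < q.2) (hw : w.1 < w.2) (x y z : Slot) :
    leg₂₃ r (leg₁₂ r (leg₂₃ r (block₃ K p q w x y z))) = ∑ x', ∑ y', ∑ z',
      (∑ k, ∑ l, ∑ m, (blockParams r φl φr q w).mat y z k l *
        (blockParams r φl φr p (Prod.map φl φl w)).mat x k x' m *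
        (blockParams r φl φr (Prod.map φr φr p) (Prod.map φr φr q)).mat m l y' z') •
      block₃ K (Prod.map φl φl (Prod.map φl φl w)) (Prod.map φr φr (Prod.map φl φl q))
        (Prod.map φr φr (Prod.map φr φr p)) x' y' z' := by
  simp only [leg₂₃_block₃ hr hind _ hq hw, map_sum, map_smul,
    leg₁₂_block₃ hr hind hp (map_lt_map φl hw),
    leg₂₃_block₃ hr hind _ (map_lt_map φr hp) (map_lt_map φr hq), map_comm hcomm]
  exact sum_reorder_right ((blockParams r φl φr q w).mat y z)
    (fun k => (blockParams r φl φr p (Prod.map φl φl w)).mat x k) _ _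

/-- The braid equation amounts to a family of matrix identities, one for each triple of blocks. -/
theorem braidEquation_iff (hu : 0 < u) (hv : 0 < v) (hcomm : ∀ x, φl (φr x) = φr (φl x)) :
    BraidEquation r ↔ ∀ p q w : HeightOnePoset u v × HeightOnePoset u v,
      p.1 < p.2 → q.1 < q.2 → w.1 < w.2 → BraidRelation
        (blockParams r φl φr p q) (blockParams r φl φr (Prod.map φr φr p) w)
        (blockParams r φl φr (Prod.map φl φl q) (Prod.map φl φl w))
        (blockParams r φl φr q w) (blockParams r φl φr p (Prod.map φl φl w))
        (blockParams r φl φr (Prod.map φr φr p) (Prod.map φr φr q)) := by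
  change leg₁₂ r ∘ₗ leg₂₃ r ∘ₗ leg₁₂ r = leg₂₃ r ∘ₗ leg₁₂ r ∘ₗ leg₂₃ r ↔ _
  constructor
  · intro h p q w hp hq hw x y z
    have h1 := (leg₁₂_leg₂₃_leg₁₂_block₃ hr hind hp hq hw x y z).symm.trans
      ((LinearMap.congr_fun h _).trans (leg₂₃_leg₁₂_leg₂₃_block₃ hr hind hcomm hp hq hw x y z))
    exact block₃_coeff_injective (map_lt_map φl (map_lt_map φl hw))
      (map_lt_map φr (map_lt_map φl hq)) (map_lt_map φr (map_lt_map φr hp)) h1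
  · intro h
    refine TensorProduct.ext (TensorProduct.ext (hom_ext fun a₁ b₁ h₁ => hom_ext fun a₂ b₂ h₂ =>
      hom_ext fun a₃ b₃ h₃ => ?_))
    obtain ⟨p, hp, x, hx⟩ := exists_block (K := K) hu hv h₁
    obtain ⟨q, hq, y, hy⟩ := exists_block (K := K) hu hv h₂
    obtain ⟨w, hw, z, hz⟩ := exists_block (K := K) hu hv h₃
    rw [hx, hy, hz]
    refine (leg₁₂_leg₂₃_leg₁₂_block₃ hr hind hp hq hw x y z).trans
      (Eq.trans ?_ (leg₂₃_leg₁₂_leg₂₃_block₃ hr hind hcomm hp hq hw x y z).symm)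
    refine Finset.sum_congr rfl fun x' _ => Finset.sum_congr rfl fun y' _ =>
      Finset.sum_congr rfl fun z' _ => ?_
    rw [h p q w hp hq hw]

end

end Braid

end HeightOnePoset

/-! ### The braid relation for constant parameters -/

namespace HeightOnePoset

open Slot

section ConstParams

variable {K : Type*} [Field K]

/-- Summation against a row of the matrix of two blocks. -/
theorem BlockParams.sum_mat_mul (P : BlockParams K) (i j : Slot) (f : Slot → Slot → K) :
    ∑ k, ∑ l, P.mat i j k l * f k l = match i, j with
      | lo, lo => f lo lo
      | lo, hi => f hi lo
      | hi, lo => f lo hi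
      | hi, hi => f hi hi
      | lo, arr => P.αlLo * f arr lo + P.βlLo * (f lo lo - f hi lo)
      | hi, arr => P.αlHi * f arr hi + P.βlHi * (f lo hi - f hi hi)
      | arr, lo => P.αrLo * f lo arr + P.βrLo * (f lo lo - f lo hi)
      | arr, hi => P.αrHi * f hi arr + P.βrHi * (f hi lo - f hi hi)
      | arr, arr => P.αlLo * P.αrHi * f arr arr + P.αlLo * P.βrHi * f arr lo +
          P.αrLo * P.βlHi * f lo arr - P.βlLo * P.αrHi * f hi arr - P.βrLo * P.αlHi * f arr hi +
          P.γ * f lo lo - P.βlLo * P.βrHi * f hi lo - P.βrLo * P.βlHi * f lo hi +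
          (P.βlLo * P.βrHi + P.βrLo * P.βlHi - P.γ) * f hi hi := by
  cases i <;> cases j <;> simp only [Slot.sum_eq, BlockParams.mat] <;> ring

/-- The parameters of all pairs of blocks when `r` is described by `ε, α, βa, βb, Γ`. -/
def constParams (ε α βa βb Γ : K) : BlockParams K where
  αlLo := α
  αlHi := ε * α
  αrLo := 1 / α
  αrHi := ε / α
  βlLo := βa
  βlHi := βb
  βrLo := -(βa / α)
  βrHi := -(ε * βb / α)
  γ := Γ

variable {ε α βa βb Γ : K}

set_option maxHeartbeats 4000000 in
/-- Three polynomial relations suffice for the braid relation: they compare the coefficients of the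
smallest vertex in the images of `(lo, hi, arr)`, `(lo, arr, arr)` and `(arr, arr, arr)`, and the
equality of all other coefficients is an algebraic consequence of them and of `ε ^ 2 = 1`. -/
theorem braidRelation_constParams (hε : ε ^ 2 = 1) (hα : α ≠ 0)
    (h1 : (α - 1) * βb = (ε * α - 1) * βa)
    (h2 : α ^ 3 * Γ - α * Γ = βa * βb - α ^ 2 * βa ^ 2 - ε * α * βa * βb + ε * α * βa ^ 2)
    (h3 : Γ * (βa * (1 + α + α ^ 2 + α ^ 3 - ε * α - ε * α ^ 2)
        - βb * (1 - α + α ^ 2 + ε * α - ε * α ^ 2 + ε * α ^ 3))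
      + βa * βb * (βa - ε * βb + ε * α * βa - ε * α * βb) = 0) :
    BraidRelation (constParams ε α βa βb Γ) (constParams ε α βa βb Γ) (constParams ε α βa βb Γ)
      (constParams ε α βa βb Γ) (constParams ε α βa βb Γ) (constParams ε α βa βb Γ) := by
  generalize hP : constParams ε α βa βb Γ = P
  intro x y z x' y' z'
  simp only [mul_assoc, ← Finset.mul_sum]
  rw [P.sum_mat_mul x y (fun k l => ∑ m, P.mat l z m z' * P.mat k m x' y'),
    P.sum_mat_mul y z (fun k l => ∑ m, P.mat x k x' m * P.mat m l y' z')]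
  -- The rows are expanded before the `3 ^ 6` coefficients are compared, so that each comparison
  -- involves few products.
  subst hP
  cases x <;> cases y <;> cases z
  all_goals
    simp only [Slot.sum_eq]
    cases x' <;> cases y' <;> cases z'
  all_goals
    simp only [BlockParams.mat, constParams, zero_mul, mul_zero, add_zero, zero_add, one_mul,
      mul_one, sub_zero]
  all_goals field_simp
  all_goals grind

variable {Γ₁ Γ₂ Γ₃ Γ₄ Γ₅ Γ₆ : K}

theorem BraidRelation.beta_relation
    (h : BraidRelation (constParams ε α βa βb Γ₁) (constParams ε α βa βb Γ₂)
      (constParams ε α βa βb Γ₃) (constParams ε α βa βb Γ₄) (constParams ε α βa βb Γ₅)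
      (constParams ε α βa βb Γ₆)) : (α - 1) * βb = (ε * α - 1) * βa := by
  have := h lo hi arr lo hi lo
  simp only [Slot.sum_eq, BlockParams.mat, constParams, zero_mul, mul_zero, add_zero, zero_add,
    one_mul, mul_one] at this
  linear_combination this

theorem BraidRelation.gamma_relations (hα : α ≠ 0)
    (h : BraidRelation (constParams ε α βa βb Γ₁) (constParams ε α βa βb Γ₂)
      (constParams ε α βa βb Γ₃) (constParams ε α βa βb Γ₄) (constParams ε α βa βb Γ₅)
      (constParams ε α βa βb Γ₆)) :
    α ^ 3 * Γ₃ - α * Γ₄ = βa * βb - α ^ 2 * βa ^ 2 - ε * α * βa * βb + ε * α * βa ^ 2 ∧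
    α * Γ₂ - α ^ 3 * Γ₅ = -βa ^ 2 - α * βa * βb + α ^ 2 * βa ^ 2 + ε * α * βa * βb ∧
    α ^ 3 * Γ₁ - α * Γ₆ = βa ^ 2 + α * βa * βb - ε * α * βa ^ 2 - ε * α ^ 2 * βa * βb := by
  refine ⟨?_, ?_, ?_⟩
  · have := h lo arr arr lo lo lo
    simp only [Slot.sum_eq, BlockParams.mat, constParams] at this
    field_simp at this
    grind
  · have := h arr lo arr lo lo lo
    simp only [Slot.sum_eq, BlockParams.mat, constParams] at this
    field_simp at this
    grind
  · have := h arr arr lo lo lo lo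
    simp only [Slot.sum_eq, BlockParams.mat, constParams] at this
    field_simp at this
    grind

theorem BraidRelation.cubic_relation (hε : ε ^ 2 = 1) (hα : α ≠ 0)
    (h : BraidRelation (constParams ε α βa βb Γ) (constParams ε α βa βb Γ)
      (constParams ε α βa βb Γ) (constParams ε α βa βb Γ) (constParams ε α βa βb Γ)
      (constParams ε α βa βb Γ)) :
    Γ * (βa * (1 + α + α ^ 2 + α ^ 3 - ε * α - ε * α ^ 2)
        - βb * (1 - α + α ^ 2 + ε * α - ε * α ^ 2 + ε * α ^ 3))
      + βa * βb * (βa - ε * βb + ε * α * βa - ε * α * βb) = 0 := by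
  have := h arr arr arr lo lo lo
  simp only [Slot.sum_eq, BlockParams.mat, constParams] at this
  field_simp at this
  grind

/-- The relations which hold for the parameters of a braided map are solved by the eight
families. -/
theorem inFamilies_of_relations (hε : ε = 1 ∨ ε = -1) (hα : α ≠ 0)
    (h1 : (α - 1) * βb = (ε * α - 1) * βa)
    (h2 : α ^ 3 * Γ - α * Γ = βa * βb - α ^ 2 * βa ^ 2 - ε * α * βa * βb + ε * α * βa ^ 2)
    (h3 : Γ * (βa * (1 + α + α ^ 2 + α ^ 3 - ε * α - ε * α ^ 2)
        - βb * (1 - α + α ^ 2 + ε * α - ε * α ^ 2 + ε * α ^ 3))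
      + βa * βb * (βa - ε * βb + ε * α * βa - ε * α * βb) = 0) :
    InFamilies ε α βa βb Γ := by
  unfold InFamilies
  by_cases hε1 : ε = 1
  · subst hε1
    by_cases hα1 : α = 1
    · subst hα1
      by_cases hβ : βb = βa
      · exact Or.inl ⟨rfl, rfl, hβ⟩
      · by_cases h20 : ringChar K = 2
        · exact Or.inr (Or.inr (Or.inl ⟨h20, rfl, rfl, hβ⟩))
        · refine Or.inr (Or.inl ⟨h20, rfl, rfl, hβ, ?_⟩)
          have h4 : (2 : K) * ((βa - βb) * (Γ + βa * βb)) = 0 := by linear_combination h3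
          rcases mul_eq_zero.1 h4 with h5 | h5
          · exact absurd h5 (Ring.two_ne_zero h20)
          · rcases mul_eq_zero.1 h5 with h6 | h6
            · exact absurd (sub_eq_zero.1 h6).symm hβ
            · exact eq_neg_of_add_eq_zero_left h6
    · have hα1' : α - 1 ≠ 0 := sub_ne_zero.2 hα1
      have hβ : βb = βa := mul_left_cancel₀ hα1' (by linear_combination h1)
      subst hβ
      by_cases hα2 : α = -1
      · exact Or.inr (Or.inr (Or.inr (Or.inl ⟨rfl, hα2, rfl⟩)))
      · have hα2' : α + 1 ≠ 0 := fun h => hα2 (eq_neg_of_add_eq_zero_left h)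
        have hsq : α ^ 2 - 1 ≠ 0 := by
          rw [show α ^ 2 - 1 = (α - 1) * (α + 1) by ring]
          exact mul_ne_zero hα1' hα2'
        refine Or.inr (Or.inr (Or.inr (Or.inr (Or.inl ⟨rfl, hα, sub_ne_zero.1 hsq, rfl, ?_⟩))))
        have h5 : Γ * α = -βb ^ 2 := mul_left_cancel₀ hsq (by linear_combination h2)
        field_simp
        exact h5
  · obtain rfl : ε = -1 := hε.resolve_left hε1
    have h20 : (2 : K) ≠ 0 := fun h => hε1 (by linear_combination -h)
    by_cases hα1 : α = 1
    · subst hα1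
      refine Or.inr (Or.inr (Or.inr (Or.inr (Or.inr (Or.inl ⟨rfl, rfl, ?_⟩)))))
      exact mul_left_cancel₀ h20 (by linear_combination h1)
    by_cases hα2 : α = -1
    · subst hα2
      refine Or.inr (Or.inr (Or.inr (Or.inr (Or.inr (Or.inr (Or.inl ⟨rfl, rfl, ?_⟩))))))
      exact mul_left_cancel₀ h20 (by linear_combination -h1)
    · have hα1' : 1 - α ≠ 0 := sub_ne_zero.2 (Ne.symm hα1)
      have hα2' : α + 1 ≠ 0 := fun h => hα2 (eq_neg_of_add_eq_zero_left h)
      have hsq : α ^ 2 - 1 ≠ 0 := by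
        rw [show α ^ 2 - 1 = -((1 - α) * (α + 1)) by ring]
        exact neg_ne_zero.2 (mul_ne_zero hα1' hα2')
      have hβ : βb = βa * ((1 + α) / (1 - α)) := by
        field_simp
        linear_combination -h1
      refine Or.inr (Or.inr (Or.inr (Or.inr (Or.inr (Or.inr (Or.inr
        ⟨rfl, hα, sub_ne_zero.1 hsq, hβ, ?_⟩))))))
      have h4 : βb * (1 - α) = βa * (1 + α) := by
        rw [hβ]
        field_simp
      have h5 : Γ * (α * (1 - α) ^ 2) = -(βa ^ 2 * (1 + α ^ 2)) :=
        mul_left_cancel₀ hsq (by linear_combination (1 - α) ^ 2 * h2 + (1 - α ^ 2) * βa * h4)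
      rw [← neg_div, eq_div_iff (mul_ne_zero hα (pow_ne_zero 2 hα1'))]
      exact h5

/-- The parameters of the eight families satisfy the relations of
`braidRelation_constParams`. -/
theorem relations_of_inFamilies (hα : α ≠ 0) (h : InFamilies ε α βa βb Γ) :
    (α - 1) * βb = (ε * α - 1) * βa ∧
    α ^ 3 * Γ - α * Γ = βa * βb - α ^ 2 * βa ^ 2 - ε * α * βa * βb + ε * α * βa ^ 2 ∧
    Γ * (βa * (1 + α + α ^ 2 + α ^ 3 - ε * α - ε * α ^ 2)
        - βb * (1 - α + α ^ 2 + ε * α - ε * α ^ 2 + ε * α ^ 3))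
      + βa * βb * (βa - ε * βb + ε * α * βa - ε * α * βb) = 0 := by
  rcases h with ⟨rfl, rfl, rfl⟩ | ⟨-, rfl, rfl, -, rfl⟩ | ⟨hc, rfl, rfl, -⟩ | ⟨rfl, rfl, rfl⟩ |
    ⟨rfl, -, -, rfl, rfl⟩ | ⟨rfl, rfl, rfl⟩ | ⟨rfl, rfl, rfl⟩ | ⟨rfl, -, hα2, rfl, rfl⟩
  · exact ⟨by ring, by ring, by ring⟩
  · exact ⟨by ring, by ring, by ring⟩
  · have h2 : (2 : K) = 0 := by
      have := ringChar.Nat.cast_ringChar (R := K)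
      rw [hc] at this
      exact_mod_cast this
    exact ⟨by ring, by ring, by linear_combination (βa - βb) * (Γ + βa * βb) * h2⟩
  · exact ⟨by ring, by ring, by ring⟩
  · refine ⟨by ring, ?_, ?_⟩ <;> field_simp <;> ring
  · exact ⟨by ring, by ring, by ring⟩
  · exact ⟨by ring, by ring, by ring⟩
  · have hα1 : 1 - α ≠ 0 := by
      rintro h
      exact hα2 (by rw [← sub_eq_zero.1 h, one_pow])
    refine ⟨?_, ?_, ?_⟩ <;> field_simp <;> ring

end ConstParams

end HeightOnePoset

/-! ### The set-type square condition on blocks -/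

namespace HeightOnePoset

open IncidenceCoalgebra Slot

section Square

variable {K : Type*} [Field K] {u v : ℕ}
  {r : IncidenceCoalgebra K (HeightOnePoset u v) ⊗[K] IncidenceCoalgebra K (HeightOnePoset u v)
    →ₗ[K] IncidenceCoalgebra K (HeightOnePoset u v) ⊗[K] IncidenceCoalgebra K (HeightOnePoset u v)}
  {φl φr : HeightOnePoset u v ≃o HeightOnePoset u v}

theorem krullDim_Icc_self (s : HeightOnePoset u v) : Order.krullDim (Set.Icc s s) = 0 := by
  rw [Set.Icc_self]
  exact Order.krullDim_eq_zero

theorem krullDim_Icc_of_lt {s t : HeightOnePoset u v} (h : s < t) :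
    Order.krullDim (Set.Icc s t) = 1 := by
  classical
  refine le_antisymm (Order.krullDim_le_one_iff.2 ?_) (Order.one_le_krullDim_iff.2
    ⟨⟨s, le_rfl, h.le⟩, ⟨t, h.le, le_rfl⟩, h⟩)
  rintro ⟨x, hx⟩
  have : x ∈ ({s, t} : Finset (HeightOnePoset u v)) := by
    rw [← Icc_of_lt h]
    exact Finset.mem_Icc.2 hx
  rcases Finset.mem_insert.1 this with rfl | h1
  · exact Or.inl fun y _ => y.2.1
  · obtain rfl := Finset.mem_singleton.1 h1
    exact Or.inr fun y _ => y.2.2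

/-- The set-type square condition has to be checked for a group-like and an arrow, in both
orders. -/
theorem setTypeSquare_iff_edges {r₀ : HeightOnePoset u v × HeightOnePoset u v →
      HeightOnePoset u v × HeightOnePoset u v} (h₀ : r₀ = fun p => (φl p.2, φr p.1)) :
    SetTypeSquareUpToHeightOne r r₀ ↔
      ∀ (x : HeightOnePoset u v) (p : HeightOnePoset u v × HeightOnePoset u v), p.1 < p.2 →
        r (r (pair₂ K (x, p.1) (x, p.2))) =
          pair₂ K (φl (φr x), φr (φl p.1)) (φl (φr x), φr (φl p.2)) ∧
        r (r (pair₂ K (p.1, x) (p.2, x))) =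
          pair₂ K (φl (φr p.1), φr (φl x)) (φl (φr p.2), φr (φl x)) := by
  subst h₀
  constructor
  · intro h x p hp
    refine ⟨h x x p.1 p.2 le_rfl hp.le ?_, h p.1 p.2 x x hp.le le_rfl ?_⟩
    · rw [krullDim_Icc_self, krullDim_Icc_of_lt hp, zero_add]
    · rw [krullDim_Icc_self, krullDim_Icc_of_lt hp, add_zero]
  · intro h a b c d hab hcd hdim
    rcases hab.eq_or_lt with rfl | hab
    · rcases hcd.eq_or_lt with rfl | hcd
      · rw [krullDim_Icc_self, krullDim_Icc_self, add_zero] at hdim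
        exact absurd hdim zero_ne_one
      · exact (h a (c, d) hcd).1
    · rcases hcd.eq_or_lt with rfl | hcd
      · exact (h c (a, b) hab).2
      · rw [krullDim_Icc_of_lt hab, krullDim_Icc_of_lt hcd, one_add_one_eq_two] at hdim
        exact absurd hdim (by decide)

theorem edge_eq_pair₂_iff {z w : HeightOnePoset u v × HeightOnePoset u v} (h : z < w) (x y : K) :
    edge K z w x y = pair₂ K z w ↔ x = 1 ∧ y = 0 := by
  classical
  constructor
  · intro he
    have h1 := congrArg (coord₂ K z w) he
    have h2 := congrArg (coord₂ K z z) he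
    rw [coord₂_edge _ _ h.le, coord₂_pair₂ _ _ h.le] at h1 h2
    simp [h.ne, h.ne.symm] at h1 h2
    exact ⟨h1, h2⟩
  · rintro ⟨rfl, rfl⟩
    simp [edge]

section

variable
  (hr : ∀ T, Coalgebra.comul (R := K) (r T) = TensorProduct.map r r (Coalgebra.comul (R := K) T))
  (hind : Induces r (fun p => (φl p.2, φr p.1)))

include hr hind

theorem map_map_left_edge (x : HeightOnePoset u v)
    {p : HeightOnePoset u v × HeightOnePoset u v} (hp : p.1 < p.2) :
    r (r (pair₂ K (x, p.1) (x, p.2))) =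
      edge K (φl (φr x), φr (φl p.1)) (φl (φr x), φr (φl p.2))
        (αl r φl φr x p * αr r φl φr (φr x) (Prod.map φl φl p))
        (αl r φl φr x p * βr r φl φr (φr x) (Prod.map φl φl p) + βl r φl φr x p) := by
  have h1 := map_right_edge hr hind (φr x) (map_lt_map φl hp)
  rw [Prod.map_fst, Prod.map_snd] at h1
  rw [map_left_edge hr hind x hp, edge, map_add, map_smul, h1, map_smul, map_sub,
    map_vertex hind, map_vertex hind, edge, edge]
  module

theorem map_map_right_edge (x : HeightOnePoset u v)
    {p : HeightOnePoset u v × HeightOnePoset u v} (hp : p.1 < p.2) :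
    r (r (pair₂ K (p.1, x) (p.2, x))) =
      edge K (φl (φr p.1), φr (φl x)) (φl (φr p.2), φr (φl x))
        (αr r φl φr x p * αl r φl φr (φl x) (Prod.map φr φr p))
        (αr r φl φr x p * βl r φl φr (φl x) (Prod.map φr φr p) + βr r φl φr x p) := by
  have h1 := map_left_edge hr hind (φl x) (map_lt_map φr hp)
  rw [Prod.map_fst, Prod.map_snd] at h1
  rw [map_right_edge hr hind x hp, edge, map_add, map_smul, h1, map_smul, map_sub,
    map_vertex hind, map_vertex hind, edge, edge]
  module

theorem setTypeSquare_iff :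
    SetTypeSquareUpToHeightOne r (fun p => (φl p.2, φr p.1)) ↔
      ∀ (x : HeightOnePoset u v) (p : HeightOnePoset u v × HeightOnePoset u v), p.1 < p.2 →
        (αl r φl φr x p * αr r φl φr (φr x) (Prod.map φl φl p) = 1 ∧
          αl r φl φr x p * βr r φl φr (φr x) (Prod.map φl φl p) + βl r φl φr x p = 0) ∧
        (αr r φl φr x p * αl r φl φr (φl x) (Prod.map φr φr p) = 1 ∧
          αr r φl φr x p * βl r φl φr (φl x) (Prod.map φr φr p) + βr r φl φr x p = 0) := by
  rw [setTypeSquare_iff_edges rfl]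
  refine forall_congr' fun x => forall_congr' fun p => forall_congr' fun hp => ?_
  rw [map_map_left_edge hr hind x hp, map_map_right_edge hr hind x hp,
    edge_eq_pair₂_iff (Prod.mk_lt_mk_iff_right.2 (φr.lt_iff_lt.2 (φl.lt_iff_lt.2 hp))),
    edge_eq_pair₂_iff (Prod.mk_lt_mk_iff_left.2 (φl.lt_iff_lt.2 (φr.lt_iff_lt.2 hp)))]

end

end Square

/-! ### Constancy of the parameters -/

section Constancy

variable {K : Type*} [Field K] {u v : ℕ} {φl φr : HeightOnePoset u v ≃o HeightOnePoset u v}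

/-- A function on the pairs `s < t` that is invariant under the cycle induced by `φl ∘ φr` is
constant. -/
theorem eq_of_invariant
    (hcycle : Equiv.Perm.IsCycleOn
      (Equiv.prodCongr (φr.trans φl).toEquiv (φr.trans φl).toEquiv)
      {p : HeightOnePoset u v × HeightOnePoset u v | p.1 < p.2})
    {B : Type*} {f : HeightOnePoset u v × HeightOnePoset u v → B}
    (hf : ∀ p, p.1 < p.2 → f (Prod.map φl φl (Prod.map φr φr p)) = f p)
    {p q : HeightOnePoset u v × HeightOnePoset u v} (hp : p.1 < p.2) (hq : q.1 < q.2) :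
    f p = f q := by
  obtain ⟨n, hn⟩ := (hcycle.2 hp hq).exists_nat_pow_eq
  rw [← hn]
  clear hn hq
  induction n generalizing p with
  | zero => rfl
  | succ n ih =>
    rw [pow_succ, Equiv.Perm.mul_apply, ← hf p hp]
    exact ih (map_lt_map φl (map_lt_map φr hp))

/-- A function of a vertex and an arrow that is invariant under moving the vertex by `φl ∘ φr`, and
under moving both, depends only on whether the vertex is minimal or maximal. -/
theorem eq_of_invariant₂
    (hcycle : Equiv.Perm.IsCycleOn
      (Equiv.prodCongr (φr.trans φl).toEquiv (φr.trans φl).toEquiv)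
      {p : HeightOnePoset u v × HeightOnePoset u v | p.1 < p.2})
    {B : Type*} {f : HeightOnePoset u v → HeightOnePoset u v × HeightOnePoset u v → B}
    (hf : ∀ x p, p.1 < p.2 → f (φl (φr x)) p = f x p)
    (hf' : ∀ x p, p.1 < p.2 → f (φl (φr x)) (Prod.map φl φl (Prod.map φr φr p)) = f x p)
    {p q p' q' : HeightOnePoset u v × HeightOnePoset u v} (hp : p.1 < p.2) (hq : q.1 < q.2)
    (hp' : p'.1 < p'.2) (hq' : q'.1 < q'.2) : f p.1 q = f p'.1 q' ∧ f p.2 q = f p'.2 q' := by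
  have h1 : ∀ x, f x q = f x q' := fun x => eq_of_invariant hcycle (f := f x)
    (fun w hw => by rw [← hf x _ (map_lt_map φl (map_lt_map φr hw)), hf' x w hw]) hq hq'
  rw [h1, h1]
  exact ⟨eq_of_invariant hcycle (f := fun w => f w.1 q') (fun w _ => hf w.1 q' hq') hp hp',
    eq_of_invariant hcycle (f := fun w => f w.2 q') (fun w _ => hf w.2 q' hq') hp hp'⟩

end Constancy

end HeightOnePoset

/-! ### Braided maps with set-type square have constant parameters -/

namespace HeightOnePoset

open IncidenceCoalgebra Slot

section Forward

variable {K : Type*} [Field K] {u v : ℕ}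
  {r : IncidenceCoalgebra K (HeightOnePoset u v) ⊗[K] IncidenceCoalgebra K (HeightOnePoset u v)
    →ₗ[K] IncidenceCoalgebra K (HeightOnePoset u v) ⊗[K] IncidenceCoalgebra K (HeightOnePoset u v)}
  {φl φr : HeightOnePoset u v ≃o HeightOnePoset u v}

theorem exists_map_eq (φ : HeightOnePoset u v ≃o HeightOnePoset u v)
    {p : HeightOnePoset u v × HeightOnePoset u v} (hp : p.1 < p.2) :
    ∃ q : HeightOnePoset u v × HeightOnePoset u v, q.1 < q.2 ∧ Prod.map φ φ q = p :=
  ⟨Prod.map φ.symm φ.symm p, φ.symm.lt_iff_lt.2 hp,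
    Prod.ext (φ.apply_symm_apply _) (φ.apply_symm_apply _)⟩

section

variable
  (hB : ∀ p q w : HeightOnePoset u v × HeightOnePoset u v,
      p.1 < p.2 → q.1 < q.2 → w.1 < w.2 → BraidRelation
        (blockParams r φl φr p q) (blockParams r φl φr (Prod.map φr φr p) w)
        (blockParams r φl φr (Prod.map φl φl q) (Prod.map φl φl w))
        (blockParams r φl φr q w) (blockParams r φl φr p (Prod.map φl φl w))
        (blockParams r φl φr (Prod.map φr φr p) (Prod.map φr φr q)))

include hB

/-- The braid equation on two group-likes and an arrow. -/
theorem vertex_relations (hu : 0 < u) (hv : 0 < v) (x y : HeightOnePoset u v)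
    {q : HeightOnePoset u v × HeightOnePoset u v} (hq : q.1 < q.2) :
    αl r φl φr (φr x) q * αl r φl φr (φl y) (Prod.map φl φl q) =
      αl r φl φr y q * αl r φl φr x (Prod.map φl φl q) ∧
    αl r φl φr (φr x) q * βl r φl φr (φl y) (Prod.map φl φl q) + βl r φl φr (φr x) q =
      αl r φl φr y q * βl r φl φr x (Prod.map φl φl q) + βl r φl φr y q := by
  obtain ⟨s, t, hst, hx⟩ := exists_lt hu hv x
  obtain ⟨s', t', hst', hy⟩ := exists_lt hu hv y
  have key := hB (s, t) (s', t') q hst hst' hq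
  rcases hx with rfl | rfl <;> rcases hy with rfl | rfl
  · have h1 := key lo lo arr arr lo lo
    have h2 := key lo lo arr lo lo lo
    simp only [Slot.sum_eq, BlockParams.mat, blockParams, Prod.map_fst, Prod.map_snd, zero_mul,
      mul_zero, add_zero, zero_add, one_mul, mul_one] at h1 h2
    exact ⟨h1, by linear_combination h2⟩
  · have h1 := key lo hi arr arr hi lo
    have h2 := key lo hi arr lo hi lo
    simp only [Slot.sum_eq, BlockParams.mat, blockParams, Prod.map_fst, Prod.map_snd, zero_mul,
      mul_zero, add_zero, zero_add, one_mul, mul_one] at h1 h2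
    exact ⟨h1, by linear_combination h2⟩
  · have h1 := key hi lo arr arr lo hi
    have h2 := key hi lo arr lo lo hi
    simp only [Slot.sum_eq, BlockParams.mat, blockParams, Prod.map_fst, Prod.map_snd, zero_mul,
      mul_zero, add_zero, zero_add, one_mul, mul_one] at h1 h2
    exact ⟨h1, by linear_combination h2⟩
  · have h1 := key hi hi arr arr hi hi
    have h2 := key hi hi arr lo hi hi
    simp only [Slot.sum_eq, BlockParams.mat, blockParams, Prod.map_fst, Prod.map_snd, zero_mul,
      mul_zero, add_zero, zero_add, one_mul, mul_one] at h1 h2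
    exact ⟨h1, by linear_combination h2⟩

variable
  (hS : ∀ (x : HeightOnePoset u v) (p : HeightOnePoset u v × HeightOnePoset u v), p.1 < p.2 →
        (αl r φl φr x p * αr r φl φr (φr x) (Prod.map φl φl p) = 1 ∧
          αl r φl φr x p * βr r φl φr (φr x) (Prod.map φl φl p) + βl r φl φr x p = 0) ∧
        (αr r φl φr x p * αl r φl φr (φl x) (Prod.map φr φr p) = 1 ∧
          αr r φl φr x p * βl r φl φr (φl x) (Prod.map φr φr p) + βr r φl φr x p = 0))
  (hcomm : ∀ x, φl (φr x) = φr (φl x))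

include hS

/-- Taking `y = φr x` in the braid equation on `(x, x) ⊗ (y, y) ⊗ (s, t)`, the coefficients of the
left edges do not change when the vertex is moved by `φl ∘ φr`. -/
theorem left_params_vertex_invariant (hu : 0 < u) (hv : 0 < v) (x : HeightOnePoset u v)
    {p : HeightOnePoset u v × HeightOnePoset u v} (hp : p.1 < p.2) :
    αl r φl φr (φl (φr x)) p = αl r φl φr x p ∧ βl r φl φr (φl (φr x)) p = βl r φl φr x p := by
  obtain ⟨q, hq, rfl⟩ := exists_map_eq φl hp
  obtain ⟨h1, h2⟩ := vertex_relations hB hu hv x (φr x) hq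
  have hne : αl r φl φr (φr x) q ≠ 0 := left_ne_zero_of_mul_eq_one (hS (φr x) q hq).1.1
  exact ⟨mul_left_cancel₀ hne h1, mul_left_cancel₀ hne (add_right_cancel h2)⟩

omit hB in
include hcomm in
/-- Applying the square condition twice, the coefficients of the left edges do not change when the
vertex and the arrow are both moved by `φl ∘ φr`. -/
theorem left_params_invariant (x : HeightOnePoset u v)
    {p : HeightOnePoset u v × HeightOnePoset u v} (hp : p.1 < p.2) :
    αl r φl φr (φl (φr x)) (Prod.map φl φl (Prod.map φr φr p)) = αl r φl φr x p ∧
    βl r φl φr (φl (φr x)) (Prod.map φl φl (Prod.map φr φr p)) = βl r φl φr x p := by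
  obtain ⟨⟨h1, h2⟩, -⟩ := hS x p hp
  obtain ⟨-, h3, h4⟩ := hS (φr x) _ (map_lt_map φl hp)
  rw [map_comm hcomm]
  have hne := right_ne_zero_of_mul_eq_one h1
  constructor
  · apply mul_left_cancel₀ hne
    rw [h3, mul_comm, h1]
  · apply mul_left_cancel₀ hne
    linear_combination h4 - αr r φl φr (φr x) (Prod.map φl φl p) * h2 +
      βr r φl φr (φr x) (Prod.map φl φl p) * h1

include hcomm in
/-- The coefficients of all edges are given by `ε, α, βa, βb`. -/
theorem exists_constParams (hu : 0 < u) (hv : 0 < v)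
    (hcycle : Equiv.Perm.IsCycleOn
      (Equiv.prodCongr (φr.trans φl).toEquiv (φr.trans φl).toEquiv)
      {p : HeightOnePoset u v × HeightOnePoset u v | p.1 < p.2})
    (hsq : ∀ p q : HeightOnePoset u v × HeightOnePoset u v, p.1 < p.2 → q.1 < q.2 →
      αl r φl φr p.1 q * αr r φl φr q.2 p = αr r φl φr q.1 p * αl r φl φr p.2 q) :
    ∃ ε α βa βb : K, (ε = 1 ∨ ε = -1) ∧ α ≠ 0 ∧
      ∀ p q : HeightOnePoset u v × HeightOnePoset u v, p.1 < p.2 → q.1 < q.2 →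
        blockParams r φl φr p q = constParams ε α βa βb (γ r φl φr p q) := by
  let o : HeightOnePoset u v × HeightOnePoset u v := (a ⟨0, hu⟩, b ⟨0, hv⟩)
  have ho : o.1 < o.2 := a_lt_b _ _
  obtain ⟨α, hα⟩ : ∃ α, αl r φl φr o.1 o = α := ⟨_, rfl⟩
  obtain ⟨α', hα'⟩ : ∃ α', αl r φl φr o.2 o = α' := ⟨_, rfl⟩
  obtain ⟨βa, hβa⟩ : ∃ βa, βl r φl φr o.1 o = βa := ⟨_, rfl⟩
  obtain ⟨βb, hβb⟩ : ∃ βb, βl r φl φr o.2 o = βb := ⟨_, rfl⟩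
  have hne : α ≠ 0 := hα ▸ left_ne_zero_of_mul_eq_one (hS o.1 o ho).1.1
  have hne' : α' ≠ 0 := hα' ▸ left_ne_zero_of_mul_eq_one (hS o.2 o ho).1.1
  have hαl : ∀ p q : HeightOnePoset u v × HeightOnePoset u v, p.1 < p.2 → q.1 < q.2 →
      αl r φl φr p.1 q = α ∧ αl r φl φr p.2 q = α' := by
    intro p q hp hq
    rw [← hα, ← hα']
    exact eq_of_invariant₂ hcycle
      (fun x p hp => (left_params_vertex_invariant hB hS hu hv x hp).1)
      (fun x p hp => (left_params_invariant hS hcomm x hp).1) hp hq ho ho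
  have hβl : ∀ p q : HeightOnePoset u v × HeightOnePoset u v, p.1 < p.2 → q.1 < q.2 →
      βl r φl φr p.1 q = βa ∧ βl r φl φr p.2 q = βb := by
    intro p q hp hq
    rw [← hβa, ← hβb]
    exact eq_of_invariant₂ hcycle
      (fun x p hp => (left_params_vertex_invariant hB hS hu hv x hp).2)
      (fun x p hp => (left_params_invariant hS hcomm x hp).2) hp hq ho ho
  have hαr : ∀ p q : HeightOnePoset u v × HeightOnePoset u v, p.1 < p.2 → q.1 < q.2 →
      (αr r φl φr q.1 p = 1 / α ∧ αr r φl φr q.2 p = 1 / α') ∧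
      (βr r φl φr q.1 p = -(βa / α) ∧ βr r φl φr q.2 p = -(βb / α')) := by
    intro p q hp hq
    obtain ⟨p, hp', rfl⟩ := exists_map_eq φl hp
    obtain ⟨q, hq', rfl⟩ := exists_map_eq φr hq
    clear hp hq
    obtain ⟨⟨h1, h2⟩, -⟩ := hS q.1 p hp'
    obtain ⟨⟨h3, h4⟩, -⟩ := hS q.2 p hp'
    rw [(hαl q p hq' hp').1] at h1 h2
    rw [(hαl q p hq' hp').2] at h3 h4
    rw [(hβl q p hq' hp').1] at h2
    rw [(hβl q p hq' hp').2] at h4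
    rw [Prod.map_fst, Prod.map_snd, ← neg_div, ← neg_div, eq_div_iff hne, eq_div_iff hne',
      eq_div_iff hne, eq_div_iff hne']
    exact ⟨⟨by linear_combination h1, by linear_combination h3⟩, by linear_combination h2,
      by linear_combination h4⟩
  -- The two paths around the square of a pair of arrows give `α / α' = α' / α`.
  have hαα' : α' = α ∨ α' = -α := by
    have h := hsq o o ho ho
    rw [(hαl o o ho ho).1, (hαl o o ho ho).2, (hαr o o ho ho).1.1, (hαr o o ho ho).1.2] at h
    field_simp at h
    exact sq_eq_sq_iff_eq_or_eq_neg.1 h.symm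
  have hε : α' / α = 1 ∨ α' / α = -1 := by
    rcases hαα' with h | h
    · exact Or.inl (by rw [h, div_self hne])
    · exact Or.inr (by rw [h, neg_div, div_self hne])
  have hαε : α' = α' / α * α := by field_simp
  have hsq1 : (α' / α) ^ 2 = 1 := by
    rcases hε with h | h <;> rw [h] <;> ring
  generalize α' / α = ε at hε hαε hsq1
  subst hαε
  have hε0 : ε ≠ 0 := left_ne_zero_of_mul hne'
  refine ⟨ε, α, βa, βb, hε, hne, fun p q hp hq => ?_⟩
  rw [blockParams, (hαl p q hp hq).1, (hαl p q hp hq).2, (hβl p q hp hq).1, (hβl p q hp hq).2,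
    (hαr p q hp hq).1.1, (hαr p q hp hq).1.2, (hαr p q hp hq).2.1, (hαr p q hp hq).2.2, constParams]
  have h1 : 1 / (ε * α) = ε / α := by
    field_simp
    exact hsq1.symm
  have h2 : βb / (ε * α) = ε * βb / α := by
    field_simp
    linear_combination -βb * hsq1
  rw [h1, h2]

end

/-- The braid equation on tensors containing two arrows forces `γ` to be constant. -/
theorem gamma_eq {ε α βa βb : K} (hε : ε ^ 2 = 1) (hα : α ≠ 0)
    (hcycle : Equiv.Perm.IsCycleOn
      (Equiv.prodCongr (φr.trans φl).toEquiv (φr.trans φl).toEquiv)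
      {p : HeightOnePoset u v × HeightOnePoset u v | p.1 < p.2})
    {g : HeightOnePoset u v × HeightOnePoset u v → HeightOnePoset u v × HeightOnePoset u v → K}
    (h : ∀ p q w : HeightOnePoset u v × HeightOnePoset u v,
      p.1 < p.2 → q.1 < q.2 → w.1 < w.2 → BraidRelation
        (constParams ε α βa βb (g p q)) (constParams ε α βa βb (g (Prod.map φr φr p) w))
        (constParams ε α βa βb (g (Prod.map φl φl q) (Prod.map φl φl w)))
        (constParams ε α βa βb (g q w)) (constParams ε α βa βb (g p (Prod.map φl φl w)))
        (constParams ε α βa βb (g (Prod.map φr φr p) (Prod.map φr φr q))))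
    {p q p' q' : HeightOnePoset u v × HeightOnePoset u v} (hp : p.1 < p.2) (hq : q.1 < q.2)
    (hp' : p'.1 < p'.2) (hq' : q'.1 < q'.2) : g p q = g p' q' := by
  have hβ := (h p p p hp hp hp).beta_relation
  have key := fun p q w hp hq hw => (h p q w hp hq hw).gamma_relations hα
  have hr : ∀ p q q', p.1 < p.2 → q.1 < q.2 → q'.1 < q'.2 → g p q = g p q' := by
    intro p q q' hp hq hq'
    refine eq_of_invariant hcycle (f := g p) (fun w hw => ?_) hq hq'
    -- Both relations involve `g (φr p) (φr w)`; their constants cancel by `hβ`.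
    obtain ⟨-, -, h1⟩ := key p w w hp hw hw
    obtain ⟨-, h2, -⟩ := key p w (Prod.map φr φr w) hp hw (map_lt_map φr hw)
    exact mul_left_cancel₀ (pow_ne_zero 3 hα) (by grind)
  have hl : ∀ p p', p.1 < p.2 → p'.1 < p'.2 → g p q = g p' q := by
    intro p p' hp hp'
    refine eq_of_invariant hcycle (f := fun p => g p q) (fun w hw => ?_) hp hp'
    -- Both relations involve `g (φr w) q`, since the second argument of `g` does not matter.
    have hw' := map_lt_map φr hw
    obtain ⟨h1, -, -⟩ := key (Prod.map φr φr w) (Prod.map φr φr w) q hw' hw' hq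
    obtain ⟨-, h2, -⟩ := key w q q hw hq hq
    rw [hr _ _ q (map_lt_map φl hw') (map_lt_map φl hq) hq] at h1
    rw [hr _ (Prod.map φl φl q) q hw (map_lt_map φl hq) hq] at h2
    exact mul_left_cancel₀ (pow_ne_zero 3 hα) (by linear_combination h1 + h2 - βa * hβ)
  rw [hl p p' hp hp', hr p' q q' hp' hq hq']

end Forward

section Parameters

variable {K : Type*} [Field K] {u v : ℕ}
  {r : IncidenceCoalgebra K (HeightOnePoset u v) ⊗[K] IncidenceCoalgebra K (HeightOnePoset u v)
    →ₗ[K] IncidenceCoalgebra K (HeightOnePoset u v) ⊗[K] IncidenceCoalgebra K (HeightOnePoset u v)}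
  {φl φr : HeightOnePoset u v ≃o HeightOnePoset u v}

theorem hasParameters_iff (hu : 0 < u) (hv : 0 < v) {ε α βa βb Γ : K} :
    HasParameters φl φr r ε α βa βb Γ ↔ (ε = 1 ∨ ε = -1) ∧ α ≠ 0 ∧
      ∀ p q : HeightOnePoset u v × HeightOnePoset u v, p.1 < p.2 → q.1 < q.2 →
        blockParams r φl φr p q = constParams ε α βa βb Γ := by
  constructor
  · rintro ⟨h1, h2, h3, h4, h5, h6, h7, h8, h9, h10, h11⟩
    refine ⟨h1, h2, ?_⟩
    rintro ⟨s, t⟩ ⟨s', t'⟩ hp hq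
    obtain ⟨i, j, rfl, rfl⟩ := lt_iff_exists.1 hp
    obtain ⟨k, l, rfl, rfl⟩ := lt_iff_exists.1 hq
    simp only [blockParams, constParams, αl, αr, βl, βr, γ, h3, h4, h5, h6, h7, h8, h9, h10, h11]
  · rintro ⟨h1, h2, h⟩
    have h' := fun i j k l => h (a i, b j) (a k, b l) (a_lt_b i j) (a_lt_b k l)
    exact ⟨h1, h2,
      fun i k l => congrArg BlockParams.αlLo (h' i ⟨0, hv⟩ k l),
      fun j k l => congrArg BlockParams.αlHi (h' ⟨0, hu⟩ j k l),
      fun i k l => congrArg BlockParams.αrLo (h' k l i ⟨0, hv⟩),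
      fun j k l => congrArg BlockParams.αrHi (h' k l ⟨0, hu⟩ j),
      fun i k l => congrArg BlockParams.βlLo (h' i ⟨0, hv⟩ k l),
      fun j k l => congrArg BlockParams.βlHi (h' ⟨0, hu⟩ j k l),
      fun i k l => congrArg BlockParams.βrLo (h' k l i ⟨0, hv⟩),
      fun j k l => congrArg BlockParams.βrHi (h' k l ⟨0, hu⟩ j),
      fun i j k l => congrArg BlockParams.γ (h' i j k l)⟩

/-- Constant parameters give a map with set-type square up to height one. -/
theorem setTypeSquare_of_constParams (hu : 0 < u) (hv : 0 < v) {ε α βa βb Γ : K}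
    (hε : ε ^ 2 = 1) (hα : α ≠ 0)
    (hr : ∀ T, Coalgebra.comul (R := K) (r T) = TensorProduct.map r r (Coalgebra.comul (R := K) T))
    (hind : Induces r (fun p => (φl p.2, φr p.1)))
    (h : ∀ p q : HeightOnePoset u v × HeightOnePoset u v, p.1 < p.2 → q.1 < q.2 →
        blockParams r φl φr p q = constParams ε α βa βb Γ) :
    SetTypeSquareUpToHeightOne r (fun p => (φl p.2, φr p.1)) := by
  rw [setTypeSquare_iff hr hind]
  intro x p hp
  have hlo : ∀ q w : HeightOnePoset u v × HeightOnePoset u v, q.1 < q.2 → w.1 < w.2 →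
      αl r φl φr q.1 w = α ∧ αr r φl φr q.1 w = 1 / α ∧
      βl r φl φr q.1 w = βa ∧ βr r φl φr q.1 w = -(βa / α) := fun q w hq hw =>
    ⟨congrArg BlockParams.αlLo (h q w hq hw), congrArg BlockParams.αrLo (h w q hw hq),
      congrArg BlockParams.βlLo (h q w hq hw), congrArg BlockParams.βrLo (h w q hw hq)⟩
  have hhi : ∀ q w : HeightOnePoset u v × HeightOnePoset u v, q.1 < q.2 → w.1 < w.2 →
      αl r φl φr q.2 w = ε * α ∧ αr r φl φr q.2 w = ε / α ∧
      βl r φl φr q.2 w = βb ∧ βr r φl φr q.2 w = -(ε * βb / α) := fun q w hq hw =>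
    ⟨congrArg BlockParams.αlHi (h q w hq hw), congrArg BlockParams.αrHi (h w q hw hq),
      congrArg BlockParams.βlHi (h q w hq hw), congrArg BlockParams.βrHi (h w q hw hq)⟩
  obtain ⟨s, t, hst, hx⟩ := exists_lt hu hv x
  have hl := map_lt_map φl hp
  have hr := map_lt_map φr hp
  rcases hx with rfl | rfl
  · obtain ⟨h1, h2, h3, h4⟩ := hlo (x, t) p hst hp
    obtain ⟨h5, h6, h7, h8⟩ := hlo (φl x, φl t) _ (φl.lt_iff_lt.2 hst) hr
    obtain ⟨h9, h10, h11, h12⟩ := hlo (φr x, φr t) _ (φr.lt_iff_lt.2 hst) hl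
    simp only at h1 h2 h3 h4 h5 h7 h10 h12
    rw [h1, h2, h3, h4, h5, h7, h10, h12]
    refine ⟨⟨?_, ?_⟩, ?_, ?_⟩ <;> field_simp <;> ring
  · obtain ⟨h1, h2, h3, h4⟩ := hhi (s, x) p hst hp
    obtain ⟨h5, h6, h7, h8⟩ := hhi (φl s, φl x) _ (φl.lt_iff_lt.2 hst) hr
    obtain ⟨h9, h10, h11, h12⟩ := hhi (φr s, φr x) _ (φr.lt_iff_lt.2 hst) hl
    simp only at h1 h2 h3 h4 h5 h7 h10 h12
    rw [h1, h2, h3, h4, h5, h7, h10, h12]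
    refine ⟨⟨?_, ?_⟩, ?_, ?_⟩ <;> field_simp <;> grind

end Parameters

end HeightOnePoset

open HeightOnePoset in
theorem mainTheorem1 {K : Type*} [Field K] (u v : ℕ) (hu : 0 < u) (hv : 0 < v)
    (huv : Nat.Coprime u v)
    (hroots : ∀ x : K, x ≠ 0 → {y : K | y ^ (u * v) = x}.ncard = u * v)
    (φl φr : HeightOnePoset u v ≃o HeightOnePoset u v)
    (hcomm : ∀ x, φl (φr x) = φr (φl x))
    (hcycle : Equiv.Perm.IsCycleOn
      (Equiv.prodCongr (φr.trans φl).toEquiv (φr.trans φl).toEquiv)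
      {p : HeightOnePoset u v × HeightOnePoset u v | p.1 < p.2})
    (r : IncidenceCoalgebra K (HeightOnePoset u v) ⊗[K] IncidenceCoalgebra K (HeightOnePoset u v)
      ≃ₗc[K]
      IncidenceCoalgebra K (HeightOnePoset u v) ⊗[K] IncidenceCoalgebra K (HeightOnePoset u v))
    (hnondeg : NonDegenerate r.toLinearEquiv.toLinearMap)
    (hinduces : Induces r.toLinearEquiv.toLinearMap (fun p => (φl p.2, φr p.1))) :
    (BraidEquation r.toLinearEquiv.toLinearMap ∧
      SetTypeSquareUpToHeightOne r.toLinearEquiv.toLinearMap (fun p => (φl p.2, φr p.1))) ↔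
    ∃ ε α βa βb Γ : K,
      HasParameters φl φr r.toLinearEquiv.toLinearMap ε α βa βb Γ ∧
      InFamilies ε α βa βb Γ := by
  have hr : ∀ T, Coalgebra.comul (R := K) (r.toLinearEquiv.toLinearMap T) =
      TensorProduct.map r.toLinearEquiv.toLinearMap r.toLinearEquiv.toLinearMap
        (Coalgebra.comul (R := K) T) :=
    fun T => (CoalgHomClass.map_comp_comul_apply r T).symm
  generalize r.toLinearEquiv.toLinearMap = f at *
  rw [braidEquation_iff hr hinduces hu hv hcomm]
  constructor
  · rintro ⟨hB, hS⟩
    rw [setTypeSquare_iff hr hinduces] at hS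
    obtain ⟨ε, α, βa, βb, hε, hα, hP⟩ := exists_constParams hB hS hcomm hu hv hcycle
      fun p q hp hq => (map_square hr hinduces hp hq).1
    have hε2 : ε ^ 2 = 1 := by
      rcases hε with rfl | rfl <;> ring
    let o : HeightOnePoset u v × HeightOnePoset u v := (a ⟨0, hu⟩, b ⟨0, hv⟩)
    have ho : o.1 < o.2 := a_lt_b _ _
    have hγ : ∀ p q : HeightOnePoset u v × HeightOnePoset u v, p.1 < p.2 → q.1 < q.2 →
        γ f φl φr p q = γ f φl φr o o := by
      intro p q hp hq
      refine gamma_eq (g := γ f φl φr) (βa := βa) (βb := βb) hε2 hα hcycle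
        (fun p q w hp hq hw => ?_) hp hq ho ho
      have := hB p q w hp hq hw
      rwa [hP _ _ hp hq, hP _ _ (map_lt_map φr hp) hw, hP _ _ (map_lt_map φl hq) (map_lt_map φl hw),
        hP _ _ hq hw, hP _ _ hp (map_lt_map φl hw),
        hP _ _ (map_lt_map φr hp) (map_lt_map φr hq)] at this
    have hP' : ∀ p q : HeightOnePoset u v × HeightOnePoset u v, p.1 < p.2 → q.1 < q.2 →
        blockParams f φl φr p q = constParams ε α βa βb (γ f φl φr o o) := fun p q hp hq => by
      rw [hP p q hp hq, hγ p q hp hq]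
    have hrel := hB o o o ho ho ho
    simp only [hP' _ _ ho ho, hP' _ _ (map_lt_map φr ho) ho, hP' _ _ ho (map_lt_map φl ho),
      hP' _ _ (map_lt_map φl ho) (map_lt_map φl ho),
      hP' _ _ (map_lt_map φr ho) (map_lt_map φr ho)] at hrel
    exact ⟨ε, α, βa, βb, γ f φl φr o o, (hasParameters_iff hu hv).2 ⟨hε, hα, hP'⟩,
      inFamilies_of_relations hε hα hrel.beta_relation (hrel.gamma_relations hα).1
        (hrel.cubic_relation hε2 hα)⟩
  · rintro ⟨ε, α, βa, βb, Γ, hpar, hfam⟩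
    obtain ⟨hε, hα, hP⟩ := (hasParameters_iff hu hv).1 hpar
    have hε2 : ε ^ 2 = 1 := by
      rcases hε with rfl | rfl <;> ring
    refine ⟨fun p q w hp hq hw => ?_, setTypeSquare_of_constParams hu hv hε2 hα hr hinduces hP⟩
    rw [hP _ _ hp hq, hP _ _ (map_lt_map φr hp) hw, hP _ _ (map_lt_map φl hq) (map_lt_map φl hw),
      hP _ _ hq hw, hP _ _ hp (map_lt_map φl hw), hP _ _ (map_lt_map φr hp) (map_lt_map φr hq)]
    obtain ⟨h1, h2, h3⟩ := relations_of_inFamilies hα hfam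
    exact braidRelation_constParams hε2 hα h1 h2 h3
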